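/- **Proposition (correlation kernel for $r=1$).** Let $N\ge 1$ be an integer, $\mu\in\mathbb R$, $\sigma>0$ with $\sigma\ne 1$. Let $\{p_j\}_{j\ge0}$, $\{q_j\}_{j\ge0}$ be arbitrary sequences of real monic polynomials with $\deg p_j=\deg q_j=j$. Put $z(u)=e^{(-1+\sigma^{-2})u^2-2\mu\sigma^{-2}u}$ and $h_{k}(x)=\int_{-\infty}^x z(u)p_k(u)\,du$ if $\sigma>1$, respectively $h_k(x)=\int_0^x z(u)p_k(u)\,du$ if $\sigma<1$. Consider the function on $\mathbb R^{N+1}$ $$ P(\lambda)=\frac1Z\,e^{-\sigma^{-2}\sum_{j=1}^{N+1}\lambda_j^2+2\mu\sigma^{-2}\sum_{j=1}^{N+1}\lambda_j}\, \det\big[q_{j-1}(\lambda_k)\big]_{j,k=1,\dots,N+1}\, \det\Big[\,[h_{k-1}(\lambda_j)]_{j=1,\dots,N+1;\,k=1,\dots,N}\ \ [1]_{j=1,\dots,N+1}\Big], $$ where $Z$ is the integral over $\mathbb R^{N+1}$ of the remaining factors. (This is the formula for the eigenvalue PDF, eigenvalues unordered, of an $N\times N$ GUE matrix bordered by $r=1$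 Gaussian row and column with mean $\mu$ and scale $\sigma$.) Let $H_p$ be the (physicists') Hermite polynomials, so that $\int_{-\infty}^\infty e^{-x^2}H_jH_k\,dx=\mathcal N_j\delta_{j,k}$ with $\mathcal N_j=2^jj!\sqrt\pi$. Let $$ a(x)=e^{(1-\sigma^{-2})x^2+2\mu\sigma^{-2}x}\int_0^x z(u)\,du,\qquad b(x)=e^{(1-\sigma^{-2})x^2+2\mu\sigma^{-2}x}, $$ and let $\alpha_p=\mathcal N_p^{-1}\int e^{-x^2}a(x)H_p(x)\,dx$, $\beta_p=\mathcal N_p^{-1}\int e^{-x^2}b(x)H_p(x)\,dx$ be their Hermite coefficients (these integrals converge absolutely). Set $$ \eta_N=b-\sum_{p=0}^{N-2}\beta_pH_p,\qquad \eta_{N+1}=a-\sum_{p=0}^{N-2}\alpha_pH_p , $$ and $\xi_j=H_{j-1}$ $(1\le j\le N+1)$, $\eta_j=H_{j-1}$ $(1\le j\le N-1)$. Then: 1. If $\sigma^2<2$, then for every real $x$ (with absolute convergence) $a(x)=\sum_{p\ge0}\alpha_pH_p(x)$, $b(x)=\sum_{p\ge0}\beta_pH_p(x)$, and hence $\eta_N(x)=\sum_{p\ge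 N-1}\beta_pH_p(x)$, $\eta_{N+1}(x)=\sum_{p\ge N-1}\alpha_pH_p(x)$. 2. $Z$ is a convergent nonzero integral, and $P$ is a symmetric probability density. It is a biorthogonal ensemble: with $\mathbf g=\big[\int_{-\infty}^\infty e^{-x^2}\xi_j(x)\eta_k(x)\,dx\big]_{j,k=1,\dots,N+1}$ one has $\det\mathbf g\ne0$ and, for all $\lambda\in\mathbb R^{N+1}$, $$ P(\lambda)=\frac1{(N+1)!\,\det\mathbf g}\prod_{l=1}^{N+1}e^{-\lambda_l^2}\,\det[\xi_j(\lambda_k)]_{j,k=1,\dots,N+1}\,\det[\eta_j(\lambda_k)]_{j,k=1,\dots,N+1}. $$ 3. Let $K_{N+1}(x,y)=e^{-(x^2+y^2)/2}\sum_{p,q=1}^{N+1}(\mathbf g^{-1})_{q,p}\,\xi_p(x)\eta_q(y)$. For all $0\le k\le N+1$ and all $x_1,\dots,x_k\in\mathbb R$ the $k$-point correlation function of $P$ is $$ \rho_{(k)}(x_1,\dots,x_k):=\frac{(N+1)!}{(N+1-k)!}\int_{\mathbb R^{N+1-k}}P(x_1,\dots,x_k,y)\,dy=\det[K_{N+1}(x_i,x_j)]_{i,j=1,\dots,k},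 $$ the integral being absolutely convergent. 4. $\beta_{N-1}\alpha_N-\beta_N\alpha_{N-1}\neq0$, and with $K^{\rm GUE}_{N-1}(x,y)=e^{-(x^2+y^2)/2}\sum_{j=1}^{N-1}\frac1{\mathcal N_{j-1}}H_{j-1}(x)H_{j-1}(y)$ one has, for all $x,y\in\mathbb R$, $$ K_{N+1}(x,y)=K^{\rm GUE}_{N-1}(x,y)+\frac{e^{-(x^2+y^2)/2}}{\beta_{N-1}\alpha_N-\beta_N\alpha_{N-1}}\Big(\Big(\frac{\alpha_N}{\mathcal N_{N-1}}H_{N-1}(x)-\frac{\alpha_{N-1}}{\mathcal N_N}H_N(x)\Big)\eta_N(y)+\Big(\frac{\beta_{N-1}}{\mathcal N_N}H_N(x)-\frac{\beta_N}{\mathcal N_{N-1}}H_{N-1}(x)\Big)\eta_{N+1}(y)\Big). $$ -/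

import Mathlib

open MeasureTheory

/-- The (physicists') Hermite polynomials: `H₀ = 1`, `H_{n+1} = 2 X H_n - H_n'`. -/
noncomputable def physHermite : ℕ → Polynomial ℝ
  | 0 => 1
  | n + 1 => Polynomial.C 2 * Polynomial.X * physHermite n - Polynomial.derivative (physHermite n)

/-- `H_n(x)` -/
noncomputable def hermiteH (n : ℕ) (x : ℝ) : ℝ := (physHermite n).eval x

/-- The Gaussian weight `exp (-x²)`. -/
noncomputable def gaussWeight (x : ℝ) : ℝ := Real.exp (-x ^ 2)

/-- `𝒩_p = 2^p p! √π`. -/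
noncomputable def hermiteNorm (p : ℕ) : ℝ := 2 ^ p * (p.factorial : ℝ) * √Real.pi

/-- The `p`-th coefficient of `f` in its expansion in Hermite polynomials, orthogonal with respect
to the weight `exp (-x²)`. -/
noncomputable def hermiteCoeff (f : ℝ → ℝ) (p : ℕ) : ℝ :=
  (∫ x : ℝ, gaussWeight x * f x * hermiteH p x) / hermiteNorm p

/-- `f` minus the terms of degree less than `n` of its Hermite expansion. Whenever the Hermite
series of `f` converges to `f`, this is the sum of its terms of degree at least `n`. -/
noncomputable def hermiteTail (f : ℝ → ℝ) (n : ℕ) (x : ℝ) : ℝ :=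
  f x - ∑ p ∈ Finset.range n, hermiteCoeff f p * hermiteH p x

/-- `z(u) = exp ((-1 + σ⁻²) u² - 2 μ σ⁻² u)`. -/
noncomputable def borderWeight (σ μ u : ℝ) : ℝ :=
  Real.exp ((-1 + (σ ^ 2)⁻¹) * u ^ 2 - 2 * μ * (σ ^ 2)⁻¹ * u)

/-- The function with Hermite coefficients `β_p`. -/
noncomputable def betaFun (σ μ x : ℝ) : ℝ :=
  Real.exp ((1 - (σ ^ 2)⁻¹) * x ^ 2 + 2 * μ * (σ ^ 2)⁻¹ * x)

/-- The function with Hermite coefficients `α_p`. -/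
noncomputable def alphaFun (σ μ x : ℝ) : ℝ :=
  Real.exp ((1 - (σ ^ 2)⁻¹) * x ^ 2 + 2 * μ * (σ ^ 2)⁻¹ * x) * ∫ u in (0 : ℝ)..x, borderWeight σ μ u

/-- `β_p` -/
noncomputable def betaCoeff (σ μ : ℝ) (p : ℕ) : ℝ := hermiteCoeff (betaFun σ μ) p

/-- `α_p` -/
noncomputable def alphaCoeff (σ μ : ℝ) (p : ℕ) : ℝ := hermiteCoeff (alphaFun σ μ) p

/-- The function `h_{k,0}(x) = ∫_{-∞}^x z(u) p_k(u) du` of a polynomial `P = p_k`. For `σ ≤ 1` the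
lower terminal `-∞` is replaced by `0`, since the integral from `-∞` need not converge (for `σ > 1`
the change of terminal alters `h_{k,0}` by an additive constant only). -/
noncomputable def hInt (σ μ : ℝ) (P : Polynomial ℝ) (x : ℝ) : ℝ :=
  open Classical in
  if 1 < σ then ∫ u in Set.Iic x, borderWeight σ μ u * P.eval u
  else ∫ u in (0 : ℝ)..x, borderWeight σ μ u * P.eval u

/-- The eigenvalue density for one border row and column (`r = 1`), up to normalisation:
`exp (-σ⁻² ∑ λ_j² + 2 μ σ⁻² ∑ λ_j) det [q_{j-1}(λ_k)] det [ [h_{k-1,0}(λ_j)]_{k ≤ N}  [1] ]`. -/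
noncomputable def borderedWeight (N : ℕ) (σ μ : ℝ) (p q : ℕ → Polynomial ℝ)
    (l : Fin (N + 1) → ℝ) : ℝ :=
  Real.exp (-(σ ^ 2)⁻¹ * ∑ j, l j ^ 2 + 2 * μ * (σ ^ 2)⁻¹ * ∑ j, l j)
    * (Matrix.of fun j k : Fin (N + 1) => (q j).eval (l k)).det
    * (Matrix.of fun j k : Fin (N + 1) =>
        if (k : ℕ) < N then hInt σ μ (p k) (l j) else 1).det

/-- The eigenvalue density for `r = 1`, as a function on `ℝ^{N+1}` normalised to total mass one
(eigenvalues not ordered). -/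
noncomputable def borderedDensity (N : ℕ) (σ μ : ℝ) (p q : ℕ → Polynomial ℝ)
    (l : Fin (N + 1) → ℝ) : ℝ :=
  borderedWeight N σ μ p q l / ∫ l' : Fin (N + 1) → ℝ, borderedWeight N σ μ p q l'

/-- The configuration `(x_1, …, x_k, y_1, …, y_{n-k})`. -/
def joinConfig {n k : ℕ} (hk : k ≤ n) (x : Fin k → ℝ) (y : Fin (n - k) → ℝ) : Fin n → ℝ :=
  fun i => Fin.append x y (Fin.cast (Nat.add_sub_of_le hk).symm i)

/-- The `k`-point correlation function
`n (n-1) ⋯ (n-k+1) ∫ f(x_1, …, x_k, y_1, …, y_{n-k}) dy` of a symmetric density `f` on `ℝ^n`. -/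
noncomputable def correlationFun {n : ℕ} (f : (Fin n → ℝ) → ℝ) {k : ℕ} (hk : k ≤ n)
    (x : Fin k → ℝ) : ℝ :=
  (n.descFactorial k : ℝ) * ∫ y : Fin (n - k) → ℝ, f (joinConfig hk x y)

/-- The unnormalised density of a biorthogonal ensemble,
`∏ w(λ_l) det [ξ_j(λ_k)] det [η_j(λ_k)]`. -/
noncomputable def biorthogonalWeight {n : ℕ} (w : ℝ → ℝ) (ξ η : Fin n → ℝ → ℝ)
    (l : Fin n → ℝ) : ℝ :=
  (∏ i, w (l i)) * (Matrix.of fun j k : Fin n => ξ j (l k)).det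
    * (Matrix.of fun j k : Fin n => η j (l k)).det

/-- The matrix of inner products `g_{jk} = ∫ w ξ_j η_k`. -/
noncomputable def gramMatrix {n : ℕ} (w : ℝ → ℝ) (ξ η : Fin n → ℝ → ℝ) :
    Matrix (Fin n) (Fin n) ℝ :=
  Matrix.of fun j k => ∫ x : ℝ, w x * ξ j x * η k x

/-- The correlation kernel of a biorthogonal ensemble,
`√(w(x) w(y)) ∑_{p,q} (g⁻¹)_{q,p} ξ_p(x) η_q(y)`. -/
noncomputable def biorthogonalKernel {n : ℕ} (w : ℝ → ℝ) (ξ η : Fin n → ℝ → ℝ) (x y : ℝ) : ℝ :=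
  √(w x * w y) * ∑ p, ∑ q, (gramMatrix w ξ η)⁻¹ q p * ξ p x * η q y

/-- The functions `ξ_j = H_{j-1}`, `j = 1, …, N + 1`. -/
noncomputable def xiFun (N : ℕ) (j : Fin (N + 1)) (x : ℝ) : ℝ := hermiteH j x

/-- `η_N`, the part of degree at least `N - 1` of `∑ β_p H_p`. -/
noncomputable def etaN (N : ℕ) (σ μ : ℝ) : ℝ → ℝ := hermiteTail (betaFun σ μ) (N - 1)

/-- `η_{N+1}`, the part of degree at least `N - 1` of `∑ α_p H_p`. -/
noncomputable def etaSucc (N : ℕ) (σ μ : ℝ) : ℝ → ℝ := hermiteTail (alphaFun σ μ) (N - 1)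

/-- The functions `η_1, …, η_{N+1}`: `η_j = H_{j-1}` for `j ≤ N - 1`, followed by `η_N` and
`η_{N+1}` (the index `j` of the code starts at `0`). -/
noncomputable def etaFun (N : ℕ) (σ μ : ℝ) (j : Fin (N + 1)) : ℝ → ℝ :=
  if (j : ℕ) + 1 < N then hermiteH j
  else if (j : ℕ) + 1 = N then etaN N σ μ else etaSucc N σ μ

/-- The correlation kernel of the `n × n` GUE. -/
noncomputable def gueKernel (n : ℕ) (x y : ℝ) : ℝ :=
  Real.exp (-(x ^ 2 + y ^ 2) / 2)
    * ∑ j ∈ Finset.range n,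
        hermiteH j x * hermiteH j y / hermiteNorm j

/-- The correlation kernel of the biorthogonal ensemble with weight `exp (-x²)` and functions
`ξ_j`, `η_j` as above. -/
noncomputable def borderedKernel (N : ℕ) (σ μ : ℝ) : ℝ → ℝ → ℝ :=
  biorthogonalKernel gaussWeight (xiFun N) (etaFun N σ μ)

/-!
Write `c = σ⁻²`, `w(x) = exp (-x²)`, `a = alphaFun`, `b = betaFun`, `z = borderWeight = 1 / b`, and
`W` for the unnormalised eigenvalue density.

*Biorthogonal structure.* The exponential prefactor of `W` is `∏ w(λ_l) b(λ_l)`. For a polynomial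
`r`, `(z r)' = z (r' + (2 (c - 1) u - 2 μ c) r)`; as `c ≠ 1`, every polynomial of degree at most
`N - 1` is of this form divided by `z`, with `r` of degree at most `N - 2`, up to a constant. So
each `b h_k` is a combination of `a`, `b` and polynomials of degree at most `N - 2`, that is, of the
`η_j`, and `W` is a constant times the weight of the biorthogonal ensemble
(`exists_borderedWeight_eq`).

*Positivity.* `h_0, …, h_{N-1}, 1` is a Chebyshev system by Rolle's theorem (`det_hInt_ne_zero`).
Hence `W` has no zeros on the convex chamber of increasing configurations, and by symmetry it has
constant sign everywhere (`borderedWeight_mul_nonneg`). So `∫ W ≠ 0`. By Andréief's identity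
(`integral_biorthogonalWeight`) this integral is a multiple of `det g`, which is therefore nonzero;
no direct computation with the coefficients is needed. As `g` is block diagonal, with a `2 × 2`
block formed by `α` and `β`, the nonvanishing of `β_{N-1} α_N - β_N α_{N-1}` and the explicit kernel
follow (`det_gramMatrix`, `borderedKernel_eq`).

*Correlations.* The kernel reproduces itself and has trace `N + 1`, so that integrating one variable
out of `det [K(x_i, x_j)]` lowers its size by one
(`integral_det_biorthogonalKernel_snoc`, through the bordered determinant identity).

*Hermite series.* `a` and `b` solve `f' = (2 s x + t) f + d` with `s = 1 - c`, `t = 2 μ c` and `d`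
equal to `1`, `0`. The equation gives a three-term recurrence for the Hermite coefficients, which
are `O(r ^ p / √(2^p p!))` for every `r² > |s| / (1 - s)`, a quotient less than one exactly for
`σ² < 2`. The polynomials grow more slowly than `R ^ p √(2^p p!)` for every `R > 1`, so the series
converges locally uniformly, together with its derivative, and solves the same equation. Its
difference to `f` is a multiple of `b` of zero mean, hence zero (`hasSum_hermite`).
-/

/-! ### Bordered determinants -/

/-- The bordered determinant identity: expanding along the border expresses the determinant through
the adjugate of the inner block. For an invertible block it is the Schur complement formula, and
both sides are continuous in the block. -/
theorem det_fromBlocks_border {ι : Type*} [Fintype ι] [DecidableEq ι] (A : Matrix ι ι ℝ)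
    (b c : ι → ℝ) (d : ℝ) :
    (Matrix.fromBlocks A (Matrix.replicateCol Unit b) (Matrix.replicateRow Unit c)
      (Matrix.of fun _ _ => d)).det = d * A.det - ∑ i, ∑ j, c i * A.adjugate i j * b j := by
  -- the Schur complement formula, for invertible `A`
  have key : ∀ A : Matrix ι ι ℝ, A.det ≠ 0 →
      (Matrix.fromBlocks A (Matrix.replicateCol Unit b) (Matrix.replicateRow Unit c)
        (Matrix.of fun _ _ => d)).det = d * A.det - ∑ i, ∑ j, c i * A.adjugate i j * b j := by
    intro A hA
    have : Invertible A := A.invertibleOfIsUnitDet (isUnit_iff_ne_zero.mpr hA)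
    rw [Matrix.det_fromBlocks₁₁, Matrix.det_unique (n := Unit), Matrix.invOf_eq_nonsing_inv,
      Matrix.inv_def]
    simp only [Matrix.sub_apply, Matrix.of_apply, Matrix.mul_apply, Matrix.replicateRow_apply,
      Matrix.replicateCol_apply, Matrix.smul_apply, Ring.inverse_eq_inv', smul_eq_mul]
    rw [mul_sub, mul_comm A.det d, Finset.mul_sum, Finset.sum_comm]
    congr 1
    refine Finset.sum_congr rfl fun i _ => ?_
    rw [Finset.sum_mul, Finset.mul_sum]
    refine Finset.sum_congr rfl fun j _ => ?_
    field_simp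
  -- perturb `A` to `A + t`, which is invertible for all but finitely many `t`
  have hcont : Continuous fun t : ℝ =>
      (Matrix.fromBlocks (A + t • 1) (Matrix.replicateCol Unit b) (Matrix.replicateRow Unit c)
        (Matrix.of fun _ _ => d)).det
      - (d * (A + t • 1).det - ∑ i, ∑ j, c i * (A + t • 1).adjugate i j * b j) := by
    have hA : Continuous fun t : ℝ => A + t • (1 : Matrix ι ι ℝ) := by fun_prop
    have hadj := hA.matrix_adjugate
    refine Continuous.sub ?_ (Continuous.sub (continuous_const.mul hA.matrix_det) ?_)
    · exact (hA.matrix_fromBlocks continuous_const continuous_const continuous_const).matrix_det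
    · exact continuous_finsetSum _ fun i _ => continuous_finsetSum _ fun j _ =>
        (continuous_const.mul (hadj.matrix_elem i j)).mul continuous_const
  have hfin : {t : ℝ | (A + t • 1).det = 0}.Finite := by
    refine ((-A).charpoly.rootSet_finite ℝ).subset fun t ht => ?_
    rw [Polynomial.mem_rootSet]
    refine ⟨(-A).charpoly_monic.ne_zero, ?_⟩
    have : (-A).charpoly.eval t = (A + t • 1).det := by
      rw [Matrix.eval_charpoly]
      congr 1
      ext i j
      simp [Matrix.scalar_apply, Matrix.smul_one_eq_diagonal, add_comm]
    simpa [this] using ht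
  have hdense : Dense {t : ℝ | (A + t • 1).det = 0}ᶜ := hfin.countable.dense_compl ℝ
  have := Continuous.ext_on hdense hcont continuous_const (g := fun _ => (0 : ℝ))
    (fun t ht => sub_eq_zero.mpr (key _ ht))
  have h0 := congrFun this 0
  simp only [zero_smul, add_zero] at h0
  linarith

/-- The bordered determinant identity, with the border in the last place of `Fin (m + 1)`. -/
theorem det_border_last {m : ℕ} (M : Matrix (Fin (m + 1)) (Fin (m + 1)) ℝ) :
    M.det = M (Fin.last m) (Fin.last m)
        * (M.submatrix Fin.castSucc Fin.castSucc).det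
      - ∑ i : Fin m, ∑ j : Fin m, M (Fin.last m) i.castSucc
        * (M.submatrix Fin.castSucc Fin.castSucc).adjugate i j * M j.castSucc (Fin.last m) := by
  rw [← det_fromBlocks_border]
  let e : Fin m ⊕ Unit ≃ Fin (m + 1) :=
    (Equiv.sumCongr (Equiv.refl _) (Equiv.ofUnique Unit (Fin 1))).trans finSumFinEquiv
  rw [← Matrix.det_submatrix_equiv_self e M]
  congr 1
  ext (i | i) (j | j) <;> rfl

/-! ### Biorthogonal ensembles -/

/-- Expansion of the weight of a biorthogonal ensemble as a signed sum of product functions. -/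
theorem biorthogonalWeight_eq_sum {n : ℕ} (w : ℝ → ℝ) (ξ η : Fin n → ℝ → ℝ) (l : Fin n → ℝ) :
    biorthogonalWeight w ξ η l
      = ∑ s : Equiv.Perm (Fin n), ∑ t : Equiv.Perm (Fin n),
          ((Equiv.Perm.sign s : ℤ) : ℝ) * ((Equiv.Perm.sign t : ℤ) : ℝ)
            * ∏ i, (w (l i) * ξ (s i) (l i) * η (t i) (l i)) := by
  unfold biorthogonalWeight
  rw [Matrix.det_apply', Matrix.det_apply', mul_assoc, Finset.sum_mul_sum, Finset.mul_sum]
  refine Finset.sum_congr rfl fun s _ => ?_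
  rw [Finset.mul_sum]
  refine Finset.sum_congr rfl fun t _ => ?_
  simp only [Matrix.of_apply, Finset.prod_mul_distrib]
  ring

theorem integrable_biorthogonalWeight {n : ℕ} {w : ℝ → ℝ} {ξ η : Fin n → ℝ → ℝ}
    (hint : ∀ i j, Integrable fun x => w x * ξ i x * η j x) :
    Integrable (biorthogonalWeight w ξ η) := by
  rw [funext fun l => biorthogonalWeight_eq_sum w ξ η l]
  refine integrable_finsetSum _ fun s _ => integrable_finsetSum _ fun t _ => ?_
  exact (Integrable.fintype_prod (f := fun i x => w x * ξ (s i) x * η (t i) x)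
    fun i => hint (s i) (t i)).const_mul _

/-- **Andréief's identity**. -/
theorem integral_biorthogonalWeight {n : ℕ} {w : ℝ → ℝ} {ξ η : Fin n → ℝ → ℝ}
    (hint : ∀ i j, Integrable fun x => w x * ξ i x * η j x) :
    ∫ l, biorthogonalWeight w ξ η l = (n.factorial : ℝ) * (gramMatrix w ξ η).det := by
  have hI : ∀ s t : Equiv.Perm (Fin n), Integrable fun l : Fin n → ℝ =>
      ∏ i, (w (l i) * ξ (s i) (l i) * η (t i) (l i)) := fun s t =>
    Integrable.fintype_prod (f := fun i x => w x * ξ (s i) x * η (t i) x)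
      fun i => hint (s i) (t i)
  simp_rw [biorthogonalWeight_eq_sum]
  rw [integral_finsetSum _ fun s _ => integrable_finsetSum _ fun t _ => (hI s t).const_mul _]
  have : ∀ s : Equiv.Perm (Fin n), ∫ l : Fin n → ℝ, ∑ t : Equiv.Perm (Fin n),
      ((Equiv.Perm.sign s : ℤ) : ℝ) * ((Equiv.Perm.sign t : ℤ) : ℝ)
        * ∏ i, (w (l i) * ξ (s i) (l i) * η (t i) (l i)) = (gramMatrix w ξ η).det := by
    intro s
    rw [integral_finsetSum _ fun t _ => (hI s t).const_mul _]
    have hprod : ∀ t : Equiv.Perm (Fin n),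
        ∫ l : Fin n → ℝ, ((Equiv.Perm.sign s : ℤ) : ℝ) * ((Equiv.Perm.sign t : ℤ) : ℝ)
          * ∏ i, (w (l i) * ξ (s i) (l i) * η (t i) (l i))
        = ((Equiv.Perm.sign s : ℤ) : ℝ) * (((Equiv.Perm.sign t : ℤ) : ℝ)
          * ∏ i, ((gramMatrix w ξ η).submatrix s id).transpose (t i) i) := by
      intro t
      rw [integral_const_mul, integral_fintype_prod_volume_eq_prod
        (fun i x => w x * ξ (s i) x * η (t i) x), mul_assoc]
      rfl
    simp_rw [hprod]
    rw [← Finset.mul_sum, ← Matrix.det_apply', Matrix.det_transpose, Matrix.det_permute,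
      ← mul_assoc, ← Int.cast_mul, ← Units.val_mul, Int.units_mul_self]
    simp
  simp_rw [this]
  rw [Finset.sum_const, Finset.card_univ, Fintype.card_perm, Fintype.card_fin, nsmul_eq_mul]

/-- Freezing some of the variables of the weight leaves an integrable function of the others. -/
theorem integrable_biorthogonalWeight_append {n k m : ℕ} {w : ℝ → ℝ} {ξ η : Fin n → ℝ → ℝ}
    (hint : ∀ i j, Integrable fun x => w x * ξ i x * η j x) (h : n = k + m) (x : Fin k → ℝ) :
    Integrable fun y : Fin m → ℝ =>
      biorthogonalWeight w ξ η fun i => Fin.append x y (Fin.cast h i) := by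
  subst h
  simp_rw [biorthogonalWeight_eq_sum]
  refine integrable_finsetSum _ fun s _ => integrable_finsetSum _ fun t _ => ?_
  refine Integrable.const_mul ?_ _
  simp only [Fin.cast_eq_self, Fin.prod_univ_add, Fin.append_left, Fin.append_right]
  refine Integrable.const_mul ?_ _
  exact Integrable.fintype_prod
    (f := fun i x => w x * ξ (s (Fin.natAdd k i)) x * η (t (Fin.natAdd k i)) x)
    fun i => hint _ _

/-- The kernel matrix is a product, so that its determinant is the density up to the factor
`det g`. -/
theorem det_biorthogonalKernel {n : ℕ} {w : ℝ → ℝ} (hw : ∀ x, 0 ≤ w x) (ξ η : Fin n → ℝ → ℝ)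
    (l : Fin n → ℝ) :
    (Matrix.of fun i j => biorthogonalKernel w ξ η (l i) (l j)).det
      = biorthogonalWeight w ξ η l / (gramMatrix w ξ η).det := by
  have hK : (Matrix.of fun i j => biorthogonalKernel w ξ η (l i) (l j))
      = Matrix.diagonal (fun i => √(w (l i)))
        * ((Matrix.of fun j k => ξ j (l k)).transpose * (gramMatrix w ξ η)⁻¹.transpose
          * Matrix.of fun j k => η j (l k)) * Matrix.diagonal (fun i => √(w (l i))) := by
    ext i j
    rw [Matrix.mul_diagonal, Matrix.diagonal_mul]
    simp only [Matrix.of_apply, biorthogonalKernel, Matrix.mul_apply, Matrix.transpose_apply]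
    rw [Real.sqrt_mul (hw _), Finset.sum_comm, Finset.mul_sum, Finset.mul_sum, Finset.sum_mul]
    refine Finset.sum_congr rfl fun q _ => ?_
    rw [Finset.sum_mul, Finset.mul_sum, Finset.mul_sum, Finset.sum_mul]
    exact Finset.sum_congr rfl fun p _ => by ring
  rw [hK]
  simp only [Matrix.det_mul, Matrix.det_diagonal, Matrix.det_transpose, biorthogonalWeight]
  rw [Matrix.det_nonsing_inv, Ring.inverse_eq_inv']
  have hs : ∏ i, w (l i) = (∏ i, √(w (l i))) * ∏ i, √(w (l i)) := by
    rw [← Finset.prod_mul_distrib]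
    exact Finset.prod_congr rfl fun i _ => (Real.mul_self_sqrt (hw _)).symm
  rw [hs]
  ring

section Kernel

variable {n : ℕ} {w : ℝ → ℝ} {ξ η : Fin n → ℝ → ℝ}

/-- The functions spanned by the `η_q` that are dual to the `ξ_p` with respect to the weight. -/
noncomputable def dualFun (w : ℝ → ℝ) (ξ η : Fin n → ℝ → ℝ) (p : Fin n) (y : ℝ) : ℝ :=
  ∑ q, (gramMatrix w ξ η)⁻¹ q p * η q y

theorem biorthogonalKernel_eq (x y : ℝ) :
    biorthogonalKernel w ξ η x y = √(w x * w y) * ∑ p, ξ p x * dualFun w ξ η p y := by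
  unfold biorthogonalKernel dualFun
  congr 1
  refine Finset.sum_congr rfl fun p _ => ?_
  rw [Finset.mul_sum]
  exact Finset.sum_congr rfl fun q _ => by ring

theorem mul_dualFun_eq (r p : Fin n) (t : ℝ) :
    w t * ξ r t * dualFun w ξ η p t
      = ∑ q, (gramMatrix w ξ η)⁻¹ q p * (w t * ξ r t * η q t) := by
  unfold dualFun
  rw [Finset.mul_sum]
  exact Finset.sum_congr rfl fun q _ => by ring

theorem integrable_mul_dualFun (hint : ∀ i j, Integrable fun x => w x * ξ i x * η j x)
    (r p : Fin n) : Integrable fun t => w t * ξ r t * dualFun w ξ η p t := by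
  simp_rw [mul_dualFun_eq]
  exact integrable_finsetSum _ fun q _ => (hint r q).const_mul _

theorem integral_mul_dualFun (hint : ∀ i j, Integrable fun x => w x * ξ i x * η j x)
    (hg : (gramMatrix w ξ η).det ≠ 0) (r p : Fin n) :
    ∫ t, w t * ξ r t * dualFun w ξ η p t = if r = p then 1 else 0 := by
  simp_rw [mul_dualFun_eq]
  rw [integral_finsetSum _ fun q _ => (hint r q).const_mul _]
  simp_rw [integral_const_mul]
  have h := congrFun (congrFun
    (Matrix.mul_nonsing_inv (gramMatrix w ξ η) (isUnit_iff_ne_zero.mpr hg)) r) p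
  rw [Matrix.mul_apply, Matrix.one_apply] at h
  rw [← h]
  exact Finset.sum_congr rfl fun q _ => mul_comm _ _

theorem biorthogonalKernel_mul_eq (hw : ∀ x, 0 ≤ w x) (x y t : ℝ) :
    biorthogonalKernel w ξ η x t * biorthogonalKernel w ξ η t y
      = √(w x * w y) * ∑ p, ∑ r, ξ p x * dualFun w ξ η r y
          * (w t * ξ r t * dualFun w ξ η p t) := by
  have hs : √(w x * w t) * √(w t * w y) = √(w x * w y) * w t := by
    rw [Real.sqrt_mul (hw _), Real.sqrt_mul (hw _), Real.sqrt_mul (hw _)]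
    linear_combination √(w x) * √(w y) * Real.mul_self_sqrt (hw t)
  rw [biorthogonalKernel_eq, biorthogonalKernel_eq, mul_mul_mul_comm, hs, Finset.sum_mul_sum,
    mul_assoc, Finset.mul_sum]
  congr 1
  refine Finset.sum_congr rfl fun p _ => ?_
  rw [Finset.mul_sum]
  exact Finset.sum_congr rfl fun r _ => by ring

theorem integrable_biorthogonalKernel_mul (hw : ∀ x, 0 ≤ w x)
    (hint : ∀ i j, Integrable fun x => w x * ξ i x * η j x) (x y : ℝ) :
    Integrable fun t => biorthogonalKernel w ξ η x t * biorthogonalKernel w ξ η t y := by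
  simp_rw [biorthogonalKernel_mul_eq hw]
  exact (integrable_finsetSum _ fun p _ => integrable_finsetSum _ fun r _ =>
    (integrable_mul_dualFun hint r p).const_mul _).const_mul _

/-- The kernel reproduces itself. -/
theorem integral_biorthogonalKernel_mul (hw : ∀ x, 0 ≤ w x)
    (hint : ∀ i j, Integrable fun x => w x * ξ i x * η j x)
    (hg : (gramMatrix w ξ η).det ≠ 0) (x y : ℝ) :
    ∫ t, biorthogonalKernel w ξ η x t * biorthogonalKernel w ξ η t y
      = biorthogonalKernel w ξ η x y := by
  have hI := fun p r : Fin n => (integrable_mul_dualFun hint r p).const_mul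
    (ξ p x * dualFun w ξ η r y)
  simp_rw [biorthogonalKernel_mul_eq hw]
  rw [integral_const_mul, integral_finsetSum _ fun p _ => integrable_finsetSum _ fun r _ => hI p r,
    biorthogonalKernel_eq]
  congr 1
  refine Finset.sum_congr rfl fun p _ => ?_
  rw [integral_finsetSum _ fun r _ => hI p r]
  simp [integral_const_mul, integral_mul_dualFun hint hg]

theorem biorthogonalKernel_self (hw : ∀ x, 0 ≤ w x) (t : ℝ) :
    biorthogonalKernel w ξ η t t = ∑ p, w t * ξ p t * dualFun w ξ η p t := by
  rw [biorthogonalKernel_eq, Real.sqrt_mul_self (hw t), Finset.mul_sum]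
  exact Finset.sum_congr rfl fun p _ => by ring

theorem integrable_biorthogonalKernel_self (hw : ∀ x, 0 ≤ w x)
    (hint : ∀ i j, Integrable fun x => w x * ξ i x * η j x) :
    Integrable fun t => biorthogonalKernel w ξ η t t := by
  simp_rw [biorthogonalKernel_self hw]
  exact integrable_finsetSum _ fun p _ => integrable_mul_dualFun hint p p

theorem integral_biorthogonalKernel_self (hw : ∀ x, 0 ≤ w x)
    (hint : ∀ i j, Integrable fun x => w x * ξ i x * η j x)
    (hg : (gramMatrix w ξ η).det ≠ 0) : ∫ t, biorthogonalKernel w ξ η t t = n := by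
  simp_rw [biorthogonalKernel_self hw]
  rw [integral_finsetSum _ fun p _ => integrable_mul_dualFun hint p p]
  simp [integral_mul_dualFun hint hg]

/-- **Dyson's integration lemma**: integrating out one variable of the determinant of a
reproducing kernel of trace `n` gives `n - k` times the determinant in the `k` others. -/
theorem integral_det_biorthogonalKernel_snoc (hw : ∀ x, 0 ≤ w x)
    (hint : ∀ i j, Integrable fun x => w x * ξ i x * η j x)
    (hg : (gramMatrix w ξ η).det ≠ 0) {k : ℕ} (x : Fin k → ℝ) :
    ∫ t, (Matrix.of fun i j : Fin (k + 1) => biorthogonalKernel w ξ η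
        (Fin.snoc (α := fun _ => ℝ) x t i) (Fin.snoc (α := fun _ => ℝ) x t j)).det
      = ((n : ℝ) - k) * (Matrix.of fun i j : Fin k =>
          biorthogonalKernel w ξ η (x i) (x j)).det := by
  set A : Matrix (Fin k) (Fin k) ℝ := Matrix.of fun i j => biorthogonalKernel w ξ η (x i) (x j)
    with hA
  have hexp : ∀ t, (Matrix.of fun i j : Fin (k + 1) => biorthogonalKernel w ξ η
        (Fin.snoc (α := fun _ => ℝ) x t i) (Fin.snoc (α := fun _ => ℝ) x t j)).det
      = biorthogonalKernel w ξ η t t * A.det - ∑ i, ∑ j, A.adjugate i j *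
        (biorthogonalKernel w ξ η (x j) t * biorthogonalKernel w ξ η t (x i)) := by
    intro t
    rw [det_border_last]
    have hsub : (Matrix.of fun i j : Fin (k + 1) => biorthogonalKernel w ξ η
        (Fin.snoc (α := fun _ => ℝ) x t i) (Fin.snoc (α := fun _ => ℝ) x t j)).submatrix
          Fin.castSucc Fin.castSucc = A := by
      ext i j
      simp [hA]
    rw [hsub]
    simp only [Matrix.of_apply, Fin.snoc_last, Fin.snoc_castSucc]
    congr 1
    exact Finset.sum_congr rfl fun i _ => Finset.sum_congr rfl fun j _ => by ring
  have hI := fun i j : Fin k =>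
    (integrable_biorthogonalKernel_mul hw hint (x j) (x i)).const_mul (A.adjugate i j)
  simp_rw [hexp]
  rw [integral_sub ((integrable_biorthogonalKernel_self hw hint).mul_const _)
    (integrable_finsetSum _ fun i _ => integrable_finsetSum _ fun j _ => hI i j),
    integral_mul_const, integral_biorthogonalKernel_self hw hint hg,
    integral_finsetSum _ fun i _ => integrable_finsetSum _ fun j _ => hI i j]
  have hrow : ∀ i : Fin k, ∫ t, ∑ j, A.adjugate i j *
      (biorthogonalKernel w ξ η (x j) t * biorthogonalKernel w ξ η t (x i)) = A.det := by
    intro i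
    rw [integral_finsetSum _ fun j _ => hI i j]
    simp_rw [integral_const_mul, integral_biorthogonalKernel_mul hw hint hg]
    have h := congrFun (congrFun (Matrix.adjugate_mul A) i) i
    rw [Matrix.mul_apply] at h
    simpa [hA] using h
  simp_rw [hrow]
  simp
  ring

/-- Integrating out the last `m` of `n` variables. The integrand is the determinant of the kernel, in
the form of `det_biorthogonalKernel`, in which its integrability is plain. -/
theorem integral_det_biorthogonalKernel_append (hw : ∀ x, 0 ≤ w x)
    (hint : ∀ i j, Integrable fun x => w x * ξ i x * η j x)
    (hg : (gramMatrix w ξ η).det ≠ 0) (m : ℕ) : ∀ (k : ℕ) (h : n = k + m) (x : Fin k → ℝ),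
    ∫ y : Fin m → ℝ, biorthogonalWeight w ξ η (fun i => Fin.append x y (Fin.cast h i))
        / (gramMatrix w ξ η).det
      = (m.factorial : ℝ) * (Matrix.of fun i j : Fin k =>
          biorthogonalKernel w ξ η (x i) (x j)).det := by
  induction m with
  | zero =>
    intro k h x
    obtain rfl : n = k := by simpa using h
    rw [det_biorthogonalKernel hw, integral_unique]
    have : ∀ y : Fin 0 → ℝ, (fun i => Fin.append x y (Fin.cast h i)) = x := by
      intro y
      ext i
      exact Fin.append_left x y i
    rw [this]
    simp [measureReal_def, volume_pi]
  | succ m ih =>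
    intro k h x
    have h' : n = (k + 1) + m := by omega
    -- split off the first of the integration variables
    have hmp := (volume_preserving_piFinSuccAbove (fun _ : Fin (m + 1) => ℝ) 0).symm
    have hcomp : ∀ (t : ℝ) (y : Fin m → ℝ),
        (fun i => Fin.append x (Fin.cons t y : Fin (m + 1) → ℝ) (Fin.cast h i))
          = fun i => Fin.append (Fin.snoc x t : Fin (k + 1) → ℝ) y (Fin.cast h' i) := by
      intro t y
      rw [Fin.append_left_snoc]
      rfl
    have hint' := (hmp.integrable_comp_emb (MeasurableEquiv.measurableEmbedding _)).mpr
      ((integrable_biorthogonalWeight_append hint h x).div_const (gramMatrix w ξ η).det)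
    rw [← hmp.integral_comp (MeasurableEquiv.measurableEmbedding _)]
    rw [Measure.volume_eq_prod]
    refine (integral_prod _ hint').trans ?_
    simp only [Function.comp_apply]
    have hstep : ∀ t : ℝ, ∫ y : Fin m → ℝ, biorthogonalWeight w ξ η (fun i => Fin.append x
        ((MeasurableEquiv.piFinSuccAbove (fun _ : Fin (m + 1) => ℝ) 0).symm (t, y))
          (Fin.cast h i)) / (gramMatrix w ξ η).det
        = (m.factorial : ℝ) * (Matrix.of fun i j : Fin (k + 1) => biorthogonalKernel w ξ η
        (Fin.snoc (α := fun _ => ℝ) x t i) (Fin.snoc (α := fun _ => ℝ) x t j)).det := by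
      intro t
      rw [← ih (k + 1) h' (Fin.snoc x t)]
      refine integral_congr_ae (Filter.Eventually.of_forall fun y => ?_)
      have hc : (MeasurableEquiv.piFinSuccAbove (fun _ : Fin (m + 1) => ℝ) 0).symm (t, y)
          = (Fin.cons t y : Fin (m + 1) → ℝ) := by
        simp [MeasurableEquiv.piFinSuccAbove, Fin.insertNthEquiv]
      simp only [hc, hcomp]
    simp only [hstep]
    rw [integral_const_mul, integral_det_biorthogonalKernel_snoc hw hint hg, Nat.factorial_succ]
    have hn : (n : ℝ) = k + (m + 1) := by exact_mod_cast h
    rw [hn]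
    push_cast
    ring

/-- The correlation functions of a biorthogonal ensemble are determinants of its kernel. -/
theorem correlationFun_biorthogonal (hw : ∀ x, 0 ≤ w x)
    (hint : ∀ i j, Integrable fun x => w x * ξ i x * η j x)
    (hg : (gramMatrix w ξ η).det ≠ 0) {k : ℕ} (hk : k ≤ n) (x : Fin k → ℝ) :
    correlationFun (fun l => biorthogonalWeight w ξ η l
        / ((n.factorial : ℝ) * (gramMatrix w ξ η).det)) hk x
      = (Matrix.of fun i j : Fin k => biorthogonalKernel w ξ η (x i) (x j)).det := by
  have h := integral_det_biorthogonalKernel_append hw hint hg (n - k) k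
    (Nat.add_sub_of_le hk).symm x
  have hn : (n.factorial : ℝ) ≠ 0 := by positivity
  have hd : ((n - k).factorial : ℝ) * (n.descFactorial k : ℝ) = n.factorial := by
    exact_mod_cast Nat.factorial_mul_descFactorial hk
  unfold correlationFun joinConfig
  have hdiv : ∀ l : Fin n → ℝ, biorthogonalWeight w ξ η l
      / ((n.factorial : ℝ) * (gramMatrix w ξ η).det)
      = (n.factorial : ℝ)⁻¹ * (biorthogonalWeight w ξ η l / (gramMatrix w ξ η).det) := by
    intro l
    field_simp
  simp_rw [hdiv]
  rw [integral_const_mul, h, ← hd]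
  have : ((n - k).factorial : ℝ) ≠ 0 := by positivity
  have : (n.descFactorial k : ℝ) ≠ 0 := fun h0 => hn (by rw [← hd, h0, mul_zero])
  field_simp

end Kernel

/-! ### Hermite polynomials -/

theorem physHermite_derivative_succ (n : ℕ) :
    Polynomial.derivative (physHermite (n + 1))
      = Polynomial.C (2 * ((n : ℝ) + 1)) * physHermite n := by
  induction n with
  | zero => simp [physHermite]
  | succ n ih =>
    have hd : Polynomial.derivative (physHermite (n + 2))
        = Polynomial.C 2 * physHermite (n + 1) + Polynomial.C 2 * Polynomial.X
          * Polynomial.derivative (physHermite (n + 1))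
          - Polynomial.derivative (Polynomial.derivative (physHermite (n + 1))) := by
      conv_lhs => rw [physHermite]
      simp
    rw [hd, ih, Polynomial.derivative_C_mul, physHermite]
    simp only [map_mul, map_add, map_one, Nat.cast_add, Nat.cast_one]
    ring

theorem natDegree_physHermite_le (n : ℕ) : (physHermite n).natDegree ≤ n := by
  induction n with
  | zero => simp [physHermite]
  | succ n ih =>
    refine (Polynomial.natDegree_sub_le _ _).trans (max_le ?_ ?_)
    · rw [mul_assoc]
      refine (Polynomial.natDegree_C_mul_le _ _).trans ?_
      refine Polynomial.natDegree_mul_le.trans ?_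
      rw [Polynomial.natDegree_X]
      omega
    · exact (Polynomial.natDegree_derivative_le _).trans (by omega)

theorem coeff_physHermite_self (n : ℕ) : (physHermite n).coeff n = 2 ^ n := by
  induction n with
  | zero => simp [physHermite]
  | succ n ih =>
    have h0 : (Polynomial.derivative (physHermite n)).coeff (n + 1) = 0 := by
      apply Polynomial.coeff_eq_zero_of_natDegree_lt
      have := Polynomial.natDegree_derivative_le (physHermite n)
      have := natDegree_physHermite_le n
      omega
    rw [physHermite, Polynomial.coeff_sub, h0, mul_assoc, Polynomial.coeff_C_mul,
      Polynomial.coeff_X_mul, ih]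
    ring

theorem natDegree_physHermite (n : ℕ) : (physHermite n).natDegree = n :=
  Polynomial.natDegree_eq_of_le_of_coeff_ne_zero (natDegree_physHermite_le n)
    (by rw [coeff_physHermite_self]; positivity)

theorem hermiteH_zero (x : ℝ) : hermiteH 0 x = 1 := by simp [hermiteH, physHermite]

theorem hermiteH_one (x : ℝ) : hermiteH 1 x = 2 * x := by simp [hermiteH, physHermite]

theorem hermiteH_add_two (n : ℕ) (x : ℝ) :
    hermiteH (n + 2) x = 2 * x * hermiteH (n + 1) x - 2 * ((n : ℝ) + 1) * hermiteH n x := by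
  unfold hermiteH
  rw [physHermite, physHermite_derivative_succ]
  simp

theorem two_mul_hermiteH (n : ℕ) (x : ℝ) :
    2 * x * hermiteH n x = hermiteH (n + 1) x + 2 * (n : ℝ) * hermiteH (n - 1) x := by
  cases n with
  | zero => simp [hermiteH_zero, hermiteH_one]
  | succ n =>
    rw [hermiteH_add_two]
    push_cast
    simp

theorem hasDerivAt_hermiteH (n : ℕ) (x : ℝ) :
    HasDerivAt (hermiteH n) (2 * (n : ℝ) * hermiteH (n - 1) x) x := by
  refine ((physHermite n).hasDerivAt x).congr_deriv ?_
  cases n with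
  | zero => simp [physHermite]
  | succ n =>
    rw [physHermite_derivative_succ]
    simp [hermiteH]

theorem continuous_gaussWeight : Continuous gaussWeight := by
  unfold gaussWeight
  fun_prop

theorem gaussWeight_pos (x : ℝ) : 0 < gaussWeight x := Real.exp_pos _

theorem hasDerivAt_gaussWeight_mul_hermiteH (n : ℕ) (x : ℝ) :
    HasDerivAt (fun x => gaussWeight x * hermiteH n x)
      (-(gaussWeight x * hermiteH (n + 1) x)) x := by
  have hw : HasDerivAt gaussWeight (gaussWeight x * -(2 * x)) x := by
    refine ((hasDerivAt_pow 2 x).neg).exp.congr_deriv ?_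
    simp [gaussWeight]
  refine (hw.mul (hasDerivAt_hermiteH n x)).congr_deriv ?_
  have h2 := two_mul_hermiteH n x
  linear_combination (-gaussWeight x) * h2

/-! ### Functions of Gaussian decay -/

/-- Continuous functions `f` such that `exp (-x²) f(x)` has Gaussian decay, up to a factor of order
one in the exponent. For these, all Hermite coefficients are given by convergent integrals. -/
def GaussDominated (f : ℝ → ℝ) : Prop :=
  Continuous f ∧ ∃ A B : ℝ, 0 < A ∧ ∀ x, |gaussWeight x * f x| ≤ Real.exp (-A * x ^ 2 + B * |x|)

theorem integrable_pow_mul_exp {A : ℝ} (hA : 0 < A) (B : ℝ) (k : ℕ) :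
    Integrable fun x : ℝ => x ^ k * Real.exp (-A * x ^ 2 + B * |x|) := by
  have h := integrable_rpow_mul_exp_neg_mul_sq (half_pos hA) (s := (k : ℝ))
    (by have : (0 : ℝ) ≤ k := k.cast_nonneg; linarith)
  refine (h.norm.mul_const (Real.exp (B ^ 2 / (2 * A)))).mono' (by fun_prop)
    (Filter.Eventually.of_forall fun x => ?_)
  rw [Real.rpow_natCast, norm_mul, norm_mul, mul_assoc]
  refine mul_le_mul_of_nonneg_left ?_ (norm_nonneg _)
  rw [Real.norm_of_nonneg (Real.exp_pos _).le, Real.norm_of_nonneg (Real.exp_pos _).le,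
    ← Real.exp_add]
  refine Real.exp_le_exp.mpr ?_
  -- complete the square in `-(A / 2) x² + B |x|`
  have hsq : 0 ≤ (A * |x| - B) ^ 2 / (2 * A) := by positivity
  have he : (A * |x| - B) ^ 2 / (2 * A) = A / 2 * x ^ 2 - B * |x| + B ^ 2 / (2 * A) := by
    field_simp
    rw [← sq_abs x]
    ring
  linarith

theorem GaussDominated.integrable_mul_eval {f : ℝ → ℝ} (hf : GaussDominated f)
    (P : Polynomial ℝ) : Integrable fun x => gaussWeight x * f x * P.eval x := by
  obtain ⟨hc, A, B, hA, hb⟩ := hf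
  simp_rw [Polynomial.eval_eq_sum_range, Finset.mul_sum]
  refine integrable_finsetSum _ fun k _ => ?_
  refine ((integrable_pow_mul_exp hA B k).norm.mul_const |P.coeff k|).mono' ?_
    (Filter.Eventually.of_forall fun x => ?_)
  · have := continuous_gaussWeight
    exact Continuous.aestronglyMeasurable (by fun_prop)
  · rw [norm_mul, norm_mul (P.coeff k), norm_mul (x ^ k), Real.norm_of_nonneg (Real.exp_pos _).le]
    have := mul_le_mul_of_nonneg_right (hb x)
      (mul_nonneg (norm_nonneg (P.coeff k)) (norm_nonneg (x ^ k)))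
    calc _ ≤ _ := this
      _ = _ := by rw [Real.norm_eq_abs (P.coeff k)]; ring

theorem GaussDominated.integrable {f : ℝ → ℝ} (hf : GaussDominated f) (j : ℕ) :
    Integrable fun x => gaussWeight x * f x * hermiteH j x :=
  hf.integrable_mul_eval (physHermite j)

theorem gaussDominated_one : GaussDominated fun _ => 1 :=
  ⟨continuous_const, 1, 0, one_pos, fun x => by simp [gaussWeight, abs_of_pos (Real.exp_pos _)]⟩

theorem integrable_gaussWeight_mul_eval (P : Polynomial ℝ) :
    Integrable fun x => gaussWeight x * P.eval x := by
  simpa using gaussDominated_one.integrable_mul_eval P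

/-! ### Orthogonality -/

theorem integrable_hermiteH_mul_eval (n : ℕ) (P : Polynomial ℝ) :
    Integrable fun x => gaussWeight x * hermiteH n x * P.eval x := by
  have := integrable_gaussWeight_mul_eval (physHermite n * P)
  simpa [hermiteH, mul_assoc] using this

theorem integral_hermiteH_succ_mul_eval (n : ℕ) (P : Polynomial ℝ) :
    ∫ x, gaussWeight x * hermiteH (n + 1) x * P.eval x
      = ∫ x, gaussWeight x * hermiteH n x * (Polynomial.derivative P).eval x := by
  have h := integral_eq_zero_of_hasDerivAt_of_integrable
    (fun x => (hasDerivAt_gaussWeight_mul_hermiteH n x).mul (P.hasDerivAt x))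
    (by
      have := (integrable_hermiteH_mul_eval n (Polynomial.derivative P)).sub
        (integrable_hermiteH_mul_eval (n + 1) P)
      refine this.congr (Filter.Eventually.of_forall fun x => ?_)
      simp only [Pi.sub_apply]
      ring)
    (integrable_hermiteH_mul_eval n P)
  have h2 : ∫ x, (gaussWeight x * hermiteH n x * (Polynomial.derivative P).eval x
      - gaussWeight x * hermiteH (n + 1) x * P.eval x) = 0 := by
    rw [← h]
    refine integral_congr_ae (Filter.Eventually.of_forall fun x => ?_)
    simp only
    ring
  rw [integral_sub (integrable_hermiteH_mul_eval n _) (integrable_hermiteH_mul_eval (n + 1) P)]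
    at h2
  linarith

theorem integral_hermiteH_mul_eval_of_lt (n : ℕ) : ∀ P : Polynomial ℝ, P.natDegree < n →
    ∫ x, gaussWeight x * hermiteH n x * P.eval x = 0 := by
  induction n with
  | zero => exact fun P hP => absurd hP (Nat.not_lt_zero _)
  | succ n ih =>
    intro P hP
    rw [integral_hermiteH_succ_mul_eval]
    by_cases h0 : P.natDegree = 0
    · rw [Polynomial.eq_C_of_natDegree_eq_zero h0]
      simp
    · exact ih _ (by have := Polynomial.natDegree_derivative_le P; omega)

theorem hermiteNorm_pos (p : ℕ) : 0 < hermiteNorm p := by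
  unfold hermiteNorm
  positivity

theorem hermiteNorm_zero : hermiteNorm 0 = √Real.pi := by simp [hermiteNorm]

theorem hermiteNorm_succ (p : ℕ) : hermiteNorm (p + 1) = 2 * ((p : ℝ) + 1) * hermiteNorm p := by
  unfold hermiteNorm
  rw [Nat.factorial_succ]
  push_cast
  ring

theorem integral_hermiteH_sq (n : ℕ) :
    ∫ x, gaussWeight x * hermiteH n x * hermiteH n x = hermiteNorm n := by
  induction n with
  | zero =>
    simp only [hermiteH_zero, mul_one, hermiteNorm_zero, gaussWeight]
    simpa using integral_gaussian 1
  | succ n ih =>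
    have h := integral_hermiteH_succ_mul_eval n (physHermite (n + 1))
    rw [physHermite_derivative_succ] at h
    rw [hermiteNorm_succ, ← ih, ← integral_const_mul]
    refine h.trans (integral_congr_ae (Filter.Eventually.of_forall fun x => ?_))
    simp [hermiteH]
    ring

theorem integral_hermiteH_mul_hermiteH (j k : ℕ) :
    (∫ x : ℝ, gaussWeight x * hermiteH j x * hermiteH k x)
      = if j = k then hermiteNorm j else 0 := by
  rcases lt_trichotomy j k with h | h | h
  · rw [if_neg h.ne, ← integral_hermiteH_mul_eval_of_lt k (physHermite j)
      (by rwa [natDegree_physHermite])]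
    exact integral_congr_ae (Filter.Eventually.of_forall fun x => mul_right_comm _ _ _)
  · subst h
    rw [if_pos rfl, integral_hermiteH_sq]
  · rw [if_neg h.ne', ← integral_hermiteH_mul_eval_of_lt j (physHermite k)
      (by rwa [natDegree_physHermite])]
    rfl

theorem integral_gaussWeight_mul_hermiteH (j : ℕ) :
    ∫ x, gaussWeight x * hermiteH j x = if j = 0 then √Real.pi else 0 := by
  have h := integral_hermiteH_mul_hermiteH j 0
  simp only [hermiteH_zero, mul_one] at h
  rw [h]
  split_ifs with hj
  · rw [hj, hermiteNorm_zero]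
  · rfl

/-! ### Growth of Hermite polynomials and coefficients -/

/-- A nonnegative sequence with `u_{p+2} ≤ A u_p + o(1) u_{p+1}` grows at most like `ρ ^ p`, for
every `ρ > √A`. -/
theorem exists_le_mul_pow_of_recurrence {u ε : ℕ → ℝ} {A ρ : ℝ} (hu : ∀ p, 0 ≤ u p)
    (hrec : ∀ p, u (p + 2) ≤ A * u p + ε p * u (p + 1))
    (hε : Filter.Tendsto ε Filter.atTop (nhds 0)) (hε0 : ∀ p, 0 ≤ ε p) (hA : 0 ≤ A)
    (hρ : 0 < ρ) (hAρ : A < ρ ^ 2) : ∃ C, 0 ≤ C ∧ ∀ p, u p ≤ C * ρ ^ p := by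
  have hlim : Filter.Tendsto (fun p => A + ε p * ρ) Filter.atTop (nhds A) := by
    simpa using (hε.mul_const ρ).const_add A
  obtain ⟨p₀, hp₀⟩ := Filter.eventually_atTop.mp (hlim.eventually (gt_mem_nhds hAρ))
  set C := ∑ i ∈ Finset.range (p₀ + 2), u i / ρ ^ i with hC
  have hC0 : 0 ≤ C := Finset.sum_nonneg fun i _ => div_nonneg (hu i) (by positivity)
  refine ⟨C, hC0, fun p => ?_⟩
  induction p using Nat.strong_induction_on with
  | _ p ih =>
    by_cases hp : p < p₀ + 2
    · have := Finset.single_le_sum (f := fun i => u i / ρ ^ i)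
        (fun i _ => div_nonneg (hu i) (by positivity)) (Finset.mem_range.mpr hp)
      exact (div_le_iff₀ (by positivity)).mp this
    · obtain ⟨k, rfl⟩ : ∃ k, p = k + 2 := ⟨p - 2, by omega⟩
      have h1 := mul_le_mul_of_nonneg_left (ih k (by omega)) hA
      have h2 := mul_le_mul_of_nonneg_left (ih (k + 1) (by omega)) (hε0 k)
      have h3 := hp₀ k (by omega)
      calc u (k + 2) ≤ A * (C * ρ ^ k) + ε k * (C * ρ ^ (k + 1)) := by linarith [hrec k]
        _ = (A + ε k * ρ) * (C * ρ ^ k) := by ring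
        _ ≤ ρ ^ 2 * (C * ρ ^ k) := mul_le_mul_of_nonneg_right h3.le (by positivity)
        _ = C * ρ ^ (k + 2) := by ring

/-- `√(2^p p!)`, which is the square root of `𝒩_p` up to a constant. -/
noncomputable def sqrtNorm (p : ℕ) : ℝ := √(2 ^ p * (p.factorial : ℝ))

theorem sqrtNorm_pos (p : ℕ) : 0 < sqrtNorm p := by
  unfold sqrtNorm
  positivity

theorem sqrtNorm_succ (p : ℕ) : sqrtNorm (p + 1) = √(2 * ((p : ℝ) + 1)) * sqrtNorm p := by
  unfold sqrtNorm
  rw [← Real.sqrt_mul (by positivity), Nat.factorial_succ]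
  congr 1
  push_cast
  ring

theorem sqrtNorm_sq (p : ℕ) : sqrtNorm p ^ 2 * √Real.pi = hermiteNorm p := by
  unfold sqrtNorm hermiteNorm
  rw [Real.sq_sqrt (by positivity)]

/-- An upper bound for `|H_p|` on `[-M, M]`, given by the three-term recurrence with all signs made
positive. -/
noncomputable def hermiteMajorant (M : ℝ) : ℕ → ℝ
  | 0 => 1
  | 1 => 2 * M
  | n + 2 => 2 * M * hermiteMajorant M (n + 1) + 2 * ((n : ℝ) + 1) * hermiteMajorant M n

theorem abs_hermiteH_le_majorant {M x : ℝ} (hx : |x| ≤ M) (n : ℕ) :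
    |hermiteH n x| ≤ hermiteMajorant M n := by
  induction n using Nat.twoStepInduction with
  | zero => simp [hermiteH_zero, hermiteMajorant]
  | one => simpa [hermiteH_one, hermiteMajorant, abs_mul] using hx
  | more n h1 h2 =>
    rw [hermiteH_add_two, hermiteMajorant]
    refine (abs_sub _ _).trans (add_le_add ?_ ?_)
    · rw [abs_mul, abs_mul, abs_two]
      have := (abs_nonneg x).trans hx
      gcongr
    · rw [abs_mul, abs_of_nonneg (by positivity : (0 : ℝ) ≤ 2 * ((n : ℝ) + 1))]
      gcongr

theorem tendsto_const_div_sqrt (K : ℝ) :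
    Filter.Tendsto (fun p : ℕ => K / √(2 * ((p : ℝ) + 2))) Filter.atTop (nhds 0) := by
  refine Filter.Tendsto.div_atTop tendsto_const_nhds ?_
  refine Real.tendsto_sqrt_atTop.comp ?_
  exact (Filter.tendsto_atTop_add_const_right _ _ tendsto_natCast_atTop_atTop).const_mul_atTop
    two_pos

/-- On bounded sets the Hermite polynomials are `O(R ^ p √(2^p p!))`, for every `R > 1`. -/
theorem exists_hermiteMajorant_le {M R : ℝ} (hM : 0 ≤ M) (hR : 1 < R) :
    ∃ C, 0 ≤ C ∧ ∀ p, hermiteMajorant M p ≤ C * R ^ p * sqrtNorm p := by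
  have hpos : ∀ p, 0 ≤ hermiteMajorant M p := fun p =>
    (abs_nonneg _).trans (abs_hermiteH_le_majorant (x := 0) (by simpa using hM) p)
  have hrec : ∀ p, hermiteMajorant M (p + 2) / sqrtNorm (p + 2)
      ≤ 1 * (hermiteMajorant M p / sqrtNorm p)
        + 2 * M / √(2 * ((p : ℝ) + 2)) * (hermiteMajorant M (p + 1) / sqrtNorm (p + 1)) := by
    intro p
    have hk := sqrtNorm_pos p
    have e1 : sqrtNorm (p + 2) = √(2 * ((p : ℝ) + 2)) * sqrtNorm (p + 1) := by
      rw [sqrtNorm_succ (p + 1)]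
      push_cast
      ring_nf
    have e2 := sqrtNorm_succ p
    have hs1 : 0 < √(2 * ((p : ℝ) + 1)) := by positivity
    have hs2 : 0 < √(2 * ((p : ℝ) + 2)) := by positivity
    have hle : √(2 * ((p : ℝ) + 1)) ≤ √(2 * ((p : ℝ) + 2)) := Real.sqrt_le_sqrt (by linarith)
    have hsq : √(2 * ((p : ℝ) + 1)) * √(2 * ((p : ℝ) + 1)) = 2 * ((p : ℝ) + 1) :=
      Real.mul_self_sqrt (by positivity)
    simp only [hermiteMajorant]
    rw [e1, add_div, add_comm, one_mul]
    generalize √(2 * ((p : ℝ) + 1)) = a at *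
    refine add_le_add ?_ (le_of_eq ?_)
    · rw [e2, ← hsq]
      calc _ = a / √(2 * ((p : ℝ) + 2)) * (hermiteMajorant M p / sqrtNorm p) := by
            field_simp
        _ ≤ 1 * (hermiteMajorant M p / sqrtNorm p) :=
            mul_le_mul_of_nonneg_right ((div_le_one hs2).mpr hle) (div_nonneg (hpos p) hk.le)
        _ = _ := one_mul _
    · have := sqrtNorm_pos (p + 1)
      field_simp
  obtain ⟨C, hC, h⟩ := exists_le_mul_pow_of_recurrence (ρ := R)
    (fun p => div_nonneg (hpos p) (sqrtNorm_pos p).le) hrec (tendsto_const_div_sqrt _)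
    (fun p => by positivity) zero_le_one (by linarith) (by nlinarith)
  exact ⟨C, hC, fun p => (div_le_iff₀ (sqrtNorm_pos p)).mp (h p)⟩

/-! ### Hermite series of solutions of a first-order equation -/

theorem exists_sq_gt {q : ℝ} (hq0 : 0 ≤ q) (hq : q < 1) : ∃ r : ℝ, 0 < r ∧ r < 1 ∧ q < r ^ 2 := by
  refine ⟨√((q + 1) / 2), by positivity, ?_, ?_⟩
  · rw [Real.sqrt_lt' one_pos]
    linarith
  · rw [Real.sq_sqrt (by positivity)]
    linarith

section Expansion

variable {f : ℝ → ℝ} {s t d : ℝ}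

theorem hermiteCoeff_mul_norm (f : ℝ → ℝ) (p : ℕ) :
    hermiteCoeff f p * hermiteNorm p = ∫ x, gaussWeight x * f x * hermiteH p x :=
  div_mul_cancel₀ _ (hermiteNorm_pos p).ne'

/-- Integration by parts against the weight raises the degree of the Hermite polynomial. -/
theorem integral_mul_hermiteH_succ (hf : GaussDominated f)
    (hode : ∀ x, HasDerivAt f ((2 * s * x + t) * f x + d) x) (p : ℕ) :
    (1 - s) * ∫ x, gaussWeight x * f x * hermiteH (p + 1) x
      = s * (2 * p) * (∫ x, gaussWeight x * f x * hermiteH (p - 1) x)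
        + t * (∫ x, gaussWeight x * f x * hermiteH p x)
        + d * ∫ x, gaussWeight x * hermiteH p x := by
  have h1 := (hf.integrable (p + 1)).const_mul (s - 1)
  have h2 := (hf.integrable (p - 1)).const_mul (s * (2 * p))
  have h3 := (hf.integrable p).const_mul t
  have h4 := (integrable_gaussWeight_mul_eval (physHermite p)).const_mul d
  have hder : ∀ x, HasDerivAt (fun x => gaussWeight x * hermiteH p x * f x)
      ((s - 1) * (gaussWeight x * f x * hermiteH (p + 1) x)
        + s * (2 * p) * (gaussWeight x * f x * hermiteH (p - 1) x)
        + t * (gaussWeight x * f x * hermiteH p x)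
        + d * (gaussWeight x * (physHermite p).eval x)) x := by
    intro x
    refine ((hasDerivAt_gaussWeight_mul_hermiteH p x).mul (hode x)).congr_deriv ?_
    have := two_mul_hermiteH p x
    have he : (physHermite p).eval x = hermiteH p x := rfl
    rw [he]
    linear_combination (s * gaussWeight x * f x) * this
  have h0 := integral_eq_zero_of_hasDerivAt_of_integrable hder
    (((h1.add h2).add h3).add h4)
    ((hf.integrable p).congr (Filter.Eventually.of_forall fun x => mul_right_comm _ _ _))
  rw [integral_add ((h1.fun_add h2).fun_add h3) h4, integral_add (h1.fun_add h2) h3,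
    integral_add h1 h2] at h0
  simp only [integral_const_mul] at h0
  change _ + _ + _ + d * ∫ x, gaussWeight x * hermiteH p x = 0 at h0
  linarith

theorem hermiteCoeff_one (hf : GaussDominated f)
    (hode : ∀ x, HasDerivAt f ((2 * s * x + t) * f x + d) x) :
    2 * (1 - s) * hermiteCoeff f 1 = t * hermiteCoeff f 0 + d := by
  have h := integral_mul_hermiteH_succ hf hode 0
  rw [← hermiteCoeff_mul_norm, ← hermiteCoeff_mul_norm, integral_gaussWeight_mul_hermiteH,
    if_pos rfl, ← hermiteNorm_zero, hermiteNorm_succ] at h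
  have := (hermiteNorm_pos 0).ne'
  apply mul_right_cancel₀ this
  push_cast at h
  linear_combination h

theorem hermiteCoeff_add_two (hf : GaussDominated f)
    (hode : ∀ x, HasDerivAt f ((2 * s * x + t) * f x + d) x) (p : ℕ) :
    2 * (1 - s) * ((p : ℝ) + 2) * hermiteCoeff f (p + 2)
      = s * hermiteCoeff f p + t * hermiteCoeff f (p + 1) := by
  have h := integral_mul_hermiteH_succ hf hode (p + 1)
  rw [Nat.add_sub_cancel, ← hermiteCoeff_mul_norm, ← hermiteCoeff_mul_norm,
    ← hermiteCoeff_mul_norm, integral_gaussWeight_mul_hermiteH, if_neg p.succ_ne_zero,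
    hermiteNorm_succ (p + 1), hermiteNorm_succ p] at h
  have := (hermiteNorm_pos p).ne'
  have h2 : (2 * ((p : ℝ) + 1)) ≠ 0 := by positivity
  apply mul_right_cancel₀ this
  apply mul_right_cancel₀ h2
  push_cast at h
  linear_combination h

/-- The coefficients decay geometrically relative to `1 / √(2^p p!)`. -/
theorem exists_hermiteCoeff_le (hf : GaussDominated f)
    (hode : ∀ x, HasDerivAt f ((2 * s * x + t) * f x + d) x) {r : ℝ} (hs : |s| < 1 - s)
    (hr : 0 < r) (hsr : |s| / (1 - s) < r ^ 2) :
    ∃ C, 0 ≤ C ∧ ∀ p, |hermiteCoeff f p| * sqrtNorm p ≤ C * r ^ p := by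
  have hc : 0 < 1 - s := (abs_nonneg s).trans_lt hs
  refine exists_le_mul_pow_of_recurrence
    (fun p => mul_nonneg (abs_nonneg _) (sqrtNorm_pos p).le) (fun p => ?_)
    (tendsto_const_div_sqrt (|t| / (1 - s))) (fun p => by positivity) (by positivity) hr hsr
  have e1 : sqrtNorm (p + 2) = √(2 * ((p : ℝ) + 2)) * sqrtNorm (p + 1) := by
    rw [sqrtNorm_succ (p + 1)]
    push_cast
    ring_nf
  have hk := sqrtNorm_pos p
  have hk1 := sqrtNorm_pos (p + 1)
  have e2 := sqrtNorm_succ p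
  have hb : 0 < √(2 * ((p : ℝ) + 2)) := by positivity
  have hle : √(2 * ((p : ℝ) + 1)) ≤ √(2 * ((p : ℝ) + 2)) := Real.sqrt_le_sqrt (by linarith)
  have hsq : √(2 * ((p : ℝ) + 2)) * √(2 * ((p : ℝ) + 2)) = 2 * ((p : ℝ) + 2) :=
    Real.mul_self_sqrt (by positivity)
  have hrec : 2 * (1 - s) * ((p : ℝ) + 2) * |hermiteCoeff f (p + 2)|
      ≤ |s| * |hermiteCoeff f p| + |t| * |hermiteCoeff f (p + 1)| := by
    have h := congrArg abs (hermiteCoeff_add_two hf hode p)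
    rw [abs_mul, abs_of_pos (by positivity)] at h
    rw [h, ← abs_mul, ← abs_mul]
    exact abs_add_le _ _
  have hrec' : √(2 * ((p : ℝ) + 2)) * √(2 * ((p : ℝ) + 2)) * |hermiteCoeff f (p + 2)|
      ≤ (|s| * |hermiteCoeff f p| + |t| * |hermiteCoeff f (p + 1)|) / (1 - s) := by
    rw [le_div_iff₀ hc, hsq]
    linarith
  generalize √(2 * ((p : ℝ) + 1)) = a at *
  generalize √(2 * ((p : ℝ) + 2)) = b at *
  rw [e1]
  calc |hermiteCoeff f (p + 2)| * (b * sqrtNorm (p + 1))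
      = b * b * |hermiteCoeff f (p + 2)| * (sqrtNorm (p + 1) / b) := by field_simp
    _ ≤ (|s| * |hermiteCoeff f p| + |t| * |hermiteCoeff f (p + 1)|) / (1 - s)
          * (sqrtNorm (p + 1) / b) := by gcongr
    _ = |s| / (1 - s) * (|hermiteCoeff f p| * sqrtNorm p) * (a / b)
          + |t| / (1 - s) / b * (|hermiteCoeff f (p + 1)| * sqrtNorm (p + 1)) := by
        rw [e2]
        field_simp
    _ ≤ |s| / (1 - s) * (|hermiteCoeff f p| * sqrtNorm p) * 1
          + |t| / (1 - s) / b * (|hermiteCoeff f (p + 1)| * sqrtNorm (p + 1)) := by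
        gcongr
        exact (div_le_one hb).mpr hle
    _ = _ := by rw [mul_one]

/-- On bounded sets, the terms of the Hermite series, of its derivative, and of the series with
`H_{p+1}` in place of `H_p` (which occurs in the expansion of `x f(x)`) are uniformly bounded by a
summable sequence. -/
theorem exists_summable_bound (hf : GaussDominated f)
    (hode : ∀ x, HasDerivAt f ((2 * s * x + t) * f x + d) x) (hs : |s| < 1 - s) {M : ℝ}
    (hM : 0 ≤ M) : ∃ u : ℕ → ℝ, Summable u ∧ ∀ x, |x| ≤ M → ∀ p,
      |hermiteCoeff f p * hermiteH p x| ≤ u p ∧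
      |hermiteCoeff f p * hermiteH (p + 1) x| ≤ u p ∧
      |hermiteCoeff f p * (2 * (p : ℝ) * hermiteH (p - 1) x)| ≤ u p := by
  have hc : 0 < 1 - s := (abs_nonneg s).trans_lt hs
  have hq : |s| / (1 - s) < 1 := (div_lt_one hc).mpr hs
  have hq0 : 0 ≤ |s| / (1 - s) := by positivity
  -- a rate `r < 1` for the coefficients and `R > 1` for the polynomials, with `r R < 1`
  obtain ⟨r, hr0, hr1, hsr⟩ := exists_sq_gt hq0 hq
  obtain ⟨R, hR1, hrR⟩ : ∃ R : ℝ, 1 < R ∧ r * R < 1 := by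
    refine ⟨2 / (1 + r), ?_, ?_⟩
    · rw [lt_div_iff₀ (by linarith)]
      linarith
    · rw [mul_div_assoc', div_lt_one (by linarith)]
      linarith
  have hR0 : 0 < R := by linarith
  obtain ⟨C, hC, hcoef⟩ := exists_hermiteCoeff_le hf hode hs hr0 hsr
  obtain ⟨D, hD, hmaj⟩ := exists_hermiteMajorant_le hM hR1
  set τ := r * R with hτ
  have hτ0 : 0 < τ := mul_pos hr0 hR0
  have hsum : Summable fun p : ℕ => C * D * (2 * R) * ((p : ℝ) + 1) * τ ^ p := by
    have h1 := summable_pow_mul_geometric_of_norm_lt_one 1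
      (by rwa [Real.norm_of_nonneg hτ0.le] : ‖τ‖ < 1)
    have h2 := summable_geometric_of_lt_one hτ0.le hrR
    refine ((h1.add h2).mul_left (C * D * (2 * R))).congr fun p => ?_
    ring
  have hsqrt : ∀ p : ℕ, √(2 * ((p : ℝ) + 1)) ≤ 2 * ((p : ℝ) + 1) := by
    intro p
    rw [Real.sqrt_le_left (by positivity)]
    have : (0 : ℝ) ≤ p := p.cast_nonneg
    nlinarith
  -- the basic bounds, in terms of the normalisation `√(2^p p!)`
  have hprod : ∀ x, |x| ≤ M → ∀ p q, |hermiteCoeff f p * hermiteH q x| * sqrtNorm p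
      ≤ C * D * r ^ p * R ^ q * sqrtNorm q := by
    intro x hx p q
    have h1 := hcoef p
    have h2 := (abs_hermiteH_le_majorant hx q).trans (hmaj q)
    rw [abs_mul]
    calc |hermiteCoeff f p| * |hermiteH q x| * sqrtNorm p
        = |hermiteCoeff f p| * sqrtNorm p * |hermiteH q x| := by ring
      _ ≤ C * r ^ p * (D * R ^ q * sqrtNorm q) := by gcongr
      _ = _ := by ring
  refine ⟨_, hsum, fun x hx p => ⟨?_, ?_, ?_⟩⟩
  · have hk := sqrtNorm_pos p
    have h := hprod x hx p p
    have h' := le_of_mul_le_mul_right h hk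
    refine h'.trans ?_
    rw [hτ, mul_pow]
    have hp : (0 : ℝ) ≤ p := p.cast_nonneg
    have : 1 ≤ (2 * R) * ((p : ℝ) + 1) := by nlinarith
    have h0 : 0 ≤ C * D * (r ^ p * R ^ p) := by positivity
    nlinarith
  · have hk := sqrtNorm_pos p
    have h := hprod x hx p (p + 1)
    rw [sqrtNorm_succ, ← mul_assoc] at h
    have h' := le_of_mul_le_mul_right h hk
    refine h'.trans ?_
    calc C * D * r ^ p * R ^ (p + 1) * √(2 * ((p : ℝ) + 1))
        ≤ C * D * r ^ p * R ^ (p + 1) * (2 * ((p : ℝ) + 1)) := by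
          have := hsqrt p
          gcongr
      _ = _ := by rw [hτ, mul_pow]; ring
  · cases p with
    | zero =>
      simp only [Nat.cast_zero, mul_zero, zero_mul, abs_zero]
      positivity
    | succ p =>
      have hk := sqrtNorm_pos p
      have h := hprod x hx (p + 1) p
      have hb : 0 < √(2 * ((p : ℝ) + 1)) := by positivity
      have hsq : √(2 * ((p : ℝ) + 1)) * √(2 * ((p : ℝ) + 1)) = 2 * ((p : ℝ) + 1) :=
        Real.mul_self_sqrt (by positivity)
      rw [sqrtNorm_succ, ← mul_assoc] at h
      have h' := le_of_mul_le_mul_right h hk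
      rw [Nat.add_sub_cancel]
      have hle := hsqrt p
      have e : |hermiteCoeff f (p + 1) * (2 * ((p + 1 : ℕ) : ℝ) * hermiteH p x)|
          = |hermiteCoeff f (p + 1) * hermiteH p x| * (2 * ((p : ℝ) + 1)) := by
        rw [← abs_of_pos (by positivity : 0 < 2 * ((p : ℝ) + 1)), ← abs_mul]
        push_cast
        ring_nf
      rw [e]
      generalize √(2 * ((p : ℝ) + 1)) = b at *
      calc |hermiteCoeff f (p + 1) * hermiteH p x| * (2 * ((p : ℝ) + 1))
          = |hermiteCoeff f (p + 1) * hermiteH p x| * b * b := by rw [← hsq]; ring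
        _ ≤ C * D * r ^ (p + 1) * R ^ p * (2 * ((p : ℝ) + 1)) := by gcongr
        _ ≤ C * D * r ^ (p + 1) * R ^ p * (R * (2 * ((((p + 1 : ℕ) : ℝ)) + 1)) * R) := by
          have hp : (0 : ℝ) ≤ p := p.cast_nonneg
          have : 2 * ((p : ℝ) + 1) ≤ R * (2 * ((((p + 1 : ℕ) : ℝ)) + 1)) * R := by
            have hRR : 1 ≤ R * R := by nlinarith
            push_cast
            nlinarith
          gcongr
        _ = _ := by rw [hτ, mul_pow]; ring

/-- The Hermite series solves the same differential equation as the function. -/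
theorem hasDerivAt_tsum_hermite (hf : GaussDominated f)
    (hode : ∀ x, HasDerivAt f ((2 * s * x + t) * f x + d) x) (hs : |s| < 1 - s) (x : ℝ) :
    HasDerivAt (fun x => ∑' p, hermiteCoeff f p * hermiteH p x)
      ((2 * s * x + t) * (∑' p, hermiteCoeff f p * hermiteH p x) + d) x := by
  obtain ⟨u, hu, hb⟩ := exists_summable_bound hf hode hs (M := |x| + 1) (by positivity)
  have hx : |x| ≤ |x| + 1 := by linarith
  have hball : ∀ y ∈ Metric.ball (0 : ℝ) (|x| + 1), |y| ≤ |x| + 1 := by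
    intro y hy
    rw [mem_ball_zero_iff, Real.norm_eq_abs] at hy
    exact hy.le
  have hder := hasDerivAt_tsum_of_isPreconnected (t := Metric.ball (0 : ℝ) (|x| + 1))
    (g := fun p y => hermiteCoeff f p * hermiteH p y)
    (g' := fun p y => hermiteCoeff f p * (2 * (p : ℝ) * hermiteH (p - 1) y)) (y₀ := x) (y := x)
    hu Metric.isOpen_ball (convex_ball _ _).isPreconnected
    (fun p y _ => (hasDerivAt_hermiteH p y).const_mul _)
    (fun p y hy => (hb y (hball y hy) p).2.2)
    (by rw [mem_ball_zero_iff, Real.norm_eq_abs]; linarith)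
    (Summable.of_norm_bounded hu fun p => (hb x hx p).1)
    (by rw [mem_ball_zero_iff, Real.norm_eq_abs]; linarith)
  refine hder.congr_deriv ?_
  have s0 : Summable fun p => hermiteCoeff f p * hermiteH p x :=
    Summable.of_norm_bounded hu fun p => (hb x hx p).1
  have s1 : Summable fun p => hermiteCoeff f p * hermiteH (p + 1) x :=
    Summable.of_norm_bounded hu fun p => (hb x hx p).2.1
  have s2 : Summable fun p => hermiteCoeff f p * (2 * (p : ℝ) * hermiteH (p - 1) x) :=
    Summable.of_norm_bounded hu fun p => (hb x hx p).2.2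
  -- the series of `2 x S(x)`, by the three-term recurrence
  have hxS : 2 * x * ∑' p, hermiteCoeff f p * hermiteH p x
      = (∑' p, hermiteCoeff f p * hermiteH (p + 1) x)
        + ∑' p, hermiteCoeff f p * (2 * (p : ℝ) * hermiteH (p - 1) x) := by
    rw [← s1.tsum_add s2, ← tsum_mul_left]
    refine tsum_congr fun p => ?_
    linear_combination hermiteCoeff f p * two_mul_hermiteH p x
  -- the series of `S'` in terms of the coefficients, by their recurrence
  have hS0 : ∑' p, hermiteCoeff f p * hermiteH p x
      = hermiteCoeff f 0 + ∑' p, hermiteCoeff f (p + 1) * hermiteH (p + 1) x := by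
    rw [s0.tsum_eq_zero_add, hermiteH_zero, mul_one]
  have s0' := (summable_nat_add_iff 1).mpr s0
  have hS' : (1 - s) * ∑' p, hermiteCoeff f p * (2 * (p : ℝ) * hermiteH (p - 1) x)
      = t * hermiteCoeff f 0 + d + ∑' p, (s * (hermiteCoeff f p * hermiteH (p + 1) x)
          + t * (hermiteCoeff f (p + 1) * hermiteH (p + 1) x)) := by
    have s2' := (summable_nat_add_iff 1).mpr s2
    rw [s2.tsum_eq_zero_add, s2'.tsum_eq_zero_add, mul_add, mul_add, ← tsum_mul_left]
    simp only [Nat.cast_zero, mul_zero, zero_mul, zero_add, Nat.add_sub_cancel, hermiteH_zero,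
      Nat.sub_self]
    congr 1
    · have := hermiteCoeff_one hf hode
      push_cast
      linear_combination this
    · refine tsum_congr fun p => ?_
      have := hermiteCoeff_add_two hf hode p
      push_cast
      linear_combination hermiteH (p + 1) x * this
  rw [(s1.mul_left s).tsum_add (s0'.mul_left t), tsum_mul_left, tsum_mul_left] at hS'
  linear_combination hS' - s * hxS - t * hS0

theorem integral_gaussWeight_mul_abs_hermiteH_le (p : ℕ) :
    ∫ x, |gaussWeight x * hermiteH p x| ≤ sqrtNorm p * √Real.pi := by
  have hk := sqrtNorm_pos p
  have hI : Integrable fun x => gaussWeight x * hermiteH p x :=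
    integrable_gaussWeight_mul_eval (physHermite p)
  have hI0 : Integrable fun x => gaussWeight x * 1 := by
    simpa using integrable_gaussWeight_mul_eval 1
  have hI2 : Integrable fun x => gaussWeight x * hermiteH p x * hermiteH p x :=
    integrable_hermiteH_mul_eval p (physHermite p)
  have hw1 : ∫ x, gaussWeight x * 1 = √Real.pi := by
    simpa [hermiteH_zero] using integral_gaussWeight_mul_hermiteH 0
  calc ∫ x, |gaussWeight x * hermiteH p x|
      ≤ ∫ x, (sqrtNorm p / 2 * (gaussWeight x * 1)
          + (2 * sqrtNorm p)⁻¹ * (gaussWeight x * hermiteH p x * hermiteH p x)) := by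
        refine integral_mono hI.abs ((hI0.const_mul _).add (hI2.const_mul _)) fun x => ?_
        -- the arithmetic-geometric mean inequality
        have hw := gaussWeight_pos x
        have hsq : 0 ≤ gaussWeight x * ((sqrtNorm p - |hermiteH p x|) ^ 2 / (2 * sqrtNorm p)) := by
          positivity
        have e : gaussWeight x * ((sqrtNorm p - |hermiteH p x|) ^ 2 / (2 * sqrtNorm p))
            = sqrtNorm p / 2 * (gaussWeight x * 1)
              + (2 * sqrtNorm p)⁻¹ * (gaussWeight x * hermiteH p x * hermiteH p x)
              - gaussWeight x * |hermiteH p x| := by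
          have : hermiteH p x * hermiteH p x = |hermiteH p x| * |hermiteH p x| :=
            (abs_mul_abs_self _).symm
          rw [mul_assoc (gaussWeight x) (hermiteH p x), this]
          field_simp
          ring
        simp only [abs_mul, abs_of_pos hw]
        linarith
    _ = sqrtNorm p * √Real.pi := by
        rw [integral_add (hI0.const_mul _) (hI2.const_mul _), integral_const_mul,
          integral_const_mul, hw1, integral_hermiteH_sq, ← sqrtNorm_sq]
        field_simp
        ring

theorem integral_gaussWeight_mul_tsum_hermite (hf : GaussDominated f)
    (hode : ∀ x, HasDerivAt f ((2 * s * x + t) * f x + d) x) (hs : |s| < 1 - s) :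
    ∫ x, gaussWeight x * (∑' p, hermiteCoeff f p * hermiteH p x) = ∫ x, gaussWeight x * f x := by
  have hc : 0 < 1 - s := (abs_nonneg s).trans_lt hs
  have hq : |s| / (1 - s) < 1 := (div_lt_one hc).mpr hs
  obtain ⟨r, hr0, hr1, hsr⟩ := exists_sq_gt (div_nonneg (abs_nonneg s) hc.le) hq
  obtain ⟨C, hC, hcoef⟩ := exists_hermiteCoeff_le hf hode hs hr0 hsr
  have hI : ∀ p, Integrable fun x => hermiteCoeff f p * (gaussWeight x * hermiteH p x) :=
    fun p => (integrable_gaussWeight_mul_eval (physHermite p)).const_mul _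
  have hsum : Summable fun p => ∫ x, ‖hermiteCoeff f p * (gaussWeight x * hermiteH p x)‖ := by
    refine Summable.of_nonneg_of_le (fun p => integral_nonneg fun x => norm_nonneg _) (fun p => ?_)
      ((summable_geometric_of_lt_one hr0.le hr1).mul_left (C * √Real.pi))
    simp only [norm_mul (hermiteCoeff f p)]
    rw [integral_const_mul]
    calc |hermiteCoeff f p| * ∫ x, |gaussWeight x * hermiteH p x|
        ≤ |hermiteCoeff f p| * (sqrtNorm p * √Real.pi) :=
          mul_le_mul_of_nonneg_left (integral_gaussWeight_mul_abs_hermiteH_le p) (abs_nonneg _)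
      _ = |hermiteCoeff f p| * sqrtNorm p * √Real.pi := by ring
      _ ≤ C * r ^ p * √Real.pi := mul_le_mul_of_nonneg_right (hcoef p) (Real.sqrt_nonneg _)
      _ = _ := by ring
  have h := (hasSum_integral_of_summable_integral_norm hI hsum).tsum_eq
  have h0 : ∀ p, ∫ x, hermiteCoeff f p * (gaussWeight x * hermiteH p x)
      = if p = 0 then hermiteCoeff f 0 * √Real.pi else 0 := by
    intro p
    rw [integral_const_mul, integral_gaussWeight_mul_hermiteH]
    split_ifs with hp
    · rw [hp]
    · rw [mul_zero]
  simp_rw [h0, tsum_ite_eq] at h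
  calc ∫ x, gaussWeight x * (∑' p, hermiteCoeff f p * hermiteH p x)
      = ∫ x, ∑' p, hermiteCoeff f p * (gaussWeight x * hermiteH p x) := by
        refine integral_congr_ae (Filter.Eventually.of_forall fun x => ?_)
        simp only
        rw [← tsum_mul_left]
        exact tsum_congr fun p => by ring
    _ = hermiteCoeff f 0 * √Real.pi := h.symm
    _ = ∫ x, gaussWeight x * f x := by
        rw [← hermiteNorm_zero, hermiteCoeff_mul_norm]
        simp [hermiteH_zero]

/-- A solution of `f' = (2 s x + t) f + d` with `s < 1/2` is the sum of its Hermite series: the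
series solves the same equation, so that the difference is a multiple of `exp (s x² + t x)`, and
this multiple is zero because the difference has zero mean with respect to the weight. -/
theorem hasSum_hermite (hf : GaussDominated f)
    (hode : ∀ x, HasDerivAt f ((2 * s * x + t) * f x + d) x) (hs : |s| < 1 - s) (x : ℝ) :
    HasSum (fun p => hermiteCoeff f p * hermiteH p x) (f x) := by
  have hc : 0 < 1 - s := (abs_nonneg s).trans_lt hs
  set S : ℝ → ℝ := fun x => ∑' p, hermiteCoeff f p * hermiteH p x with hS
  set b : ℝ → ℝ := fun x => Real.exp (s * x ^ 2 + t * x) with hb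
  have hbinv : ∀ y, HasDerivAt (fun y => (f y - S y) * Real.exp (-(s * y ^ 2 + t * y))) 0 y := by
    intro y
    have h1 := (hode y).sub (hasDerivAt_tsum_hermite hf hode hs y)
    have h2 := ((((hasDerivAt_pow 2 y).const_mul s).add ((hasDerivAt_id y).const_mul t)).neg).exp
    refine (h1.mul h2).congr_deriv ?_
    simp only [Pi.add_apply, Pi.sub_apply, Pi.neg_apply, id]
    push_cast
    ring
  have hconst := is_const_of_deriv_eq_zero (fun y => (hbinv y).differentiableAt)
    (fun y => (hbinv y).deriv)
  have hdiff : ∀ y, f y - S y = (f 0 - S 0) * b y := by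
    intro y
    have h := hconst y 0
    simp only [Real.exp_neg] at h
    rw [← div_eq_mul_inv, div_eq_iff (Real.exp_pos _).ne'] at h
    rw [h]
    simp [hb]
  have hwb : ∀ y, gaussWeight y * b y = Real.exp (-(1 - s) * y ^ 2 + t * y) := by
    intro y
    simp only [gaussWeight, hb, ← Real.exp_add]
    ring_nf
  have hbI : Integrable fun y => gaussWeight y * b y := by
    refine (integrable_pow_mul_exp hc |t| 0).mono' ?_ (Filter.Eventually.of_forall fun y => ?_)
    · simp_rw [hwb]
      exact Continuous.aestronglyMeasurable (by fun_prop)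
    · rw [hwb, Real.norm_of_nonneg (Real.exp_pos _).le, pow_zero, one_mul, ← abs_mul]
      exact Real.exp_le_exp.mpr (by linarith [le_abs_self (t * y)])
  have hbpos : 0 < ∫ y, gaussWeight y * b y := by
    refine integral_pos_of_integrable_nonneg_nonzero (x := 0) ?_ hbI ?_ ?_
    · have := continuous_gaussWeight
      fun_prop
    · exact fun y => (mul_pos (gaussWeight_pos y) (Real.exp_pos _)).le
    · exact (mul_pos (gaussWeight_pos _) (Real.exp_pos _)).ne'
  have hfI : Integrable fun y => gaussWeight y * f y := by
    simpa [hermiteH_zero] using hf.integrable 0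
  have hz : (f 0 - S 0) * ∫ y, gaussWeight y * b y = 0 := by
    have h := integral_gaussWeight_mul_tsum_hermite hf hode hs
    have e : ∀ y, gaussWeight y * (∑' p, hermiteCoeff f p * hermiteH p y)
        = gaussWeight y * f y - (f 0 - S 0) * (gaussWeight y * b y) := by
      intro y
      linear_combination -gaussWeight y * hdiff y
    simp_rw [e] at h
    rw [integral_sub hfI (hbI.const_mul _), integral_const_mul] at h
    linarith
  have hfS : f x = S x := by
    have h := hdiff x
    rw [(mul_eq_zero.mp hz).resolve_right hbpos.ne', zero_mul] at h
    linarith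
  obtain ⟨u, hu, hbd⟩ := exists_summable_bound hf hode hs (M := |x|) (abs_nonneg x)
  rw [hfS]
  exact (Summable.of_norm_bounded hu fun p => (hbd x le_rfl p).1).hasSum

end Expansion

/-! ### The functions with coefficients `α_p` and `β_p` -/

section Border

variable {σ μ : ℝ}

theorem borderWeight_pos (u : ℝ) : 0 < borderWeight σ μ u := Real.exp_pos _

theorem betaFun_mul_borderWeight (x : ℝ) : betaFun σ μ x * borderWeight σ μ x = 1 := by
  unfold betaFun borderWeight
  rw [← Real.exp_add, ← Real.exp_zero]
  ring_nf

theorem continuous_borderWeight : Continuous (borderWeight σ μ) := by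
  unfold borderWeight
  fun_prop

theorem continuous_betaFun : Continuous (betaFun σ μ) := by
  unfold betaFun
  fun_prop

theorem hasDerivAt_betaFun (x : ℝ) : HasDerivAt (betaFun σ μ)
    ((2 * (1 - (σ ^ 2)⁻¹) * x + 2 * μ * (σ ^ 2)⁻¹) * betaFun σ μ x + 0) x := by
  refine (((hasDerivAt_pow 2 x).const_mul (1 - (σ ^ 2)⁻¹)).add
    ((hasDerivAt_id x).const_mul (2 * μ * (σ ^ 2)⁻¹))).exp.congr_deriv ?_
  simp only [betaFun, Pi.add_apply, id]
  push_cast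
  ring

theorem hasDerivAt_borderWeight (x : ℝ) : HasDerivAt (borderWeight σ μ)
    (borderWeight σ μ x * (2 * (-1 + (σ ^ 2)⁻¹) * x - 2 * μ * (σ ^ 2)⁻¹)) x := by
  refine (((hasDerivAt_pow 2 x).const_mul (-1 + (σ ^ 2)⁻¹)).sub
    ((hasDerivAt_id x).const_mul (2 * μ * (σ ^ 2)⁻¹))).exp.congr_deriv ?_
  simp only [borderWeight, Pi.sub_apply, id]
  push_cast
  ring

/-- The fundamental theorem of calculus for the primitives of `z P`. -/
theorem hasDerivAt_integral_borderWeight (P : Polynomial ℝ) (x : ℝ) :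
    HasDerivAt (fun x => ∫ u in (0 : ℝ)..x, borderWeight σ μ u * P.eval u)
      (borderWeight σ μ x * P.eval x) x := by
  have hc : Continuous fun u => borderWeight σ μ u * P.eval u :=
    continuous_borderWeight.mul P.continuous
  exact hc.integral_hasStrictDerivAt 0 x |>.hasDerivAt

theorem alphaFun_eq (x : ℝ) :
    alphaFun σ μ x = betaFun σ μ x * ∫ u in (0 : ℝ)..x, borderWeight σ μ u := rfl

theorem hasDerivAt_alphaFun (x : ℝ) : HasDerivAt (alphaFun σ μ)
    ((2 * (1 - (σ ^ 2)⁻¹) * x + 2 * μ * (σ ^ 2)⁻¹) * alphaFun σ μ x + 1) x := by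
  have h := hasDerivAt_integral_borderWeight (σ := σ) (μ := μ) 1 x
  simp only [Polynomial.eval_one, mul_one] at h
  refine ((hasDerivAt_betaFun x).mul h).congr_deriv ?_
  rw [betaFun_mul_borderWeight, alphaFun_eq]
  ring

theorem continuous_alphaFun : Continuous (alphaFun σ μ) :=
  continuous_iff_continuousAt.mpr fun x => (hasDerivAt_alphaFun x).continuousAt

theorem gaussWeight_mul_betaFun (x : ℝ) : gaussWeight x * betaFun σ μ x
    = Real.exp (-(σ ^ 2)⁻¹ * x ^ 2 + 2 * μ * (σ ^ 2)⁻¹ * x) := by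
  unfold gaussWeight betaFun
  rw [← Real.exp_add]
  ring_nf

theorem gaussDominated_betaFun (hσ : 0 < σ) : GaussDominated (betaFun σ μ) := by
  refine ⟨continuous_betaFun, (σ ^ 2)⁻¹, |2 * μ * (σ ^ 2)⁻¹|, by positivity, fun x => ?_⟩
  rw [gaussWeight_mul_betaFun, abs_of_pos (Real.exp_pos _), ← abs_mul]
  exact Real.exp_le_exp.mpr (by linarith [le_abs_self (2 * μ * (σ ^ 2)⁻¹ * x)])

theorem gaussDominated_alphaFun (hσ : 0 < σ) : GaussDominated (alphaFun σ μ) := by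
  have hc : 0 < (σ ^ 2)⁻¹ := by positivity
  set c := (σ ^ 2)⁻¹ with hcdef
  set B := |2 * μ * c| with hB
  -- `z(u) ≤ exp (m x² + B |x|)` for `|u| ≤ |x|`
  set m := max (c - 1) 0 with hm
  have hm1 : c - 1 ≤ m := le_max_left _ _
  have hm0 : 0 ≤ m := le_max_right _ _
  have hmc : 0 < c - m := by
    rcases max_choice (c - 1) 0 with h | h <;> rw [hm, h] <;> linarith
  refine ⟨continuous_alphaFun, c - m, 2 * B + 1, hmc, fun x => ?_⟩
  have hz : ∀ u ∈ Set.uIoc 0 x, ‖borderWeight σ μ u‖ ≤ Real.exp (m * x ^ 2 + B * |x|) := by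
    intro u hu
    have hux : |u| ≤ |x| := by
      have := Set.abs_sub_left_of_mem_uIcc (Set.uIoc_subset_uIcc hu)
      simpa using this
    have hux2 : u ^ 2 ≤ x ^ 2 := sq_le_sq.mpr hux
    rw [Real.norm_of_nonneg (borderWeight_pos u).le]
    refine Real.exp_le_exp.mpr ?_
    have h1 : (-1 + (σ ^ 2)⁻¹) * u ^ 2 ≤ m * x ^ 2 :=
      (mul_le_mul_of_nonneg_right (by linarith : -1 + (σ ^ 2)⁻¹ ≤ m) (sq_nonneg u)).trans
        (mul_le_mul_of_nonneg_left hux2 hm0)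
    have h2 : -(2 * μ * c * u) ≤ B * |x| := by
      refine (neg_le_abs _).trans ?_
      rw [abs_mul]
      exact mul_le_mul_of_nonneg_left hux (abs_nonneg _)
    linarith
  have hint := intervalIntegral.norm_integral_le_of_norm_le_const hz
  rw [sub_zero, Real.norm_eq_abs] at hint
  rw [alphaFun_eq, ← mul_assoc, gaussWeight_mul_betaFun, abs_mul, abs_of_pos (Real.exp_pos _)]
  have hx : |x| ≤ Real.exp |x| := by linarith [Real.add_one_le_exp |x|]
  have hB2 : 2 * μ * c * x ≤ B * |x| := by
    rw [hB, ← abs_mul]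
    exact le_abs_self _
  calc Real.exp (-c * x ^ 2 + 2 * μ * c * x) * |∫ u in (0 : ℝ)..x, borderWeight σ μ u|
      ≤ Real.exp (-c * x ^ 2 + B * |x|) * (Real.exp (m * x ^ 2 + B * |x|) * Real.exp |x|) := by
        gcongr
        exact hint.trans (mul_le_mul_of_nonneg_left hx (Real.exp_pos _).le)
    _ = _ := by
        rw [← Real.exp_add, ← Real.exp_add]
        ring_nf

/-! ### The primitives `h_k` -/

theorem integrable_borderWeight_mul_eval (hσ : 1 < σ) (P : Polynomial ℝ) :
    Integrable fun u => borderWeight σ μ u * P.eval u := by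
  have hc : (σ ^ 2)⁻¹ < 1 := inv_lt_one_of_one_lt₀ (by nlinarith)
  have h : ∀ u, gaussWeight u * (Real.exp (u ^ 2) * borderWeight σ μ u) = borderWeight σ μ u := by
    intro u
    rw [← mul_assoc, gaussWeight, ← Real.exp_add]
    simp
  have hd : GaussDominated fun u => Real.exp (u ^ 2) * borderWeight σ μ u := by
    have := continuous_borderWeight (σ := σ) (μ := μ)
    refine ⟨by fun_prop, 1 - (σ ^ 2)⁻¹, |2 * μ * (σ ^ 2)⁻¹|, by linarith, fun u => ?_⟩
    rw [h, abs_of_pos (borderWeight_pos u), ← abs_mul]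
    refine Real.exp_le_exp.mpr ?_
    linarith [neg_le_abs (2 * μ * (σ ^ 2)⁻¹ * u)]
  simpa only [h] using hd.integrable_mul_eval P

theorem exists_hInt_eq (σ μ : ℝ) (P : Polynomial ℝ) :
    ∃ κ : ℝ, ∀ x, hInt σ μ P x = κ + ∫ u in (0 : ℝ)..x, borderWeight σ μ u * P.eval u := by
  by_cases h : 1 < σ
  · refine ⟨∫ u in Set.Iic 0, borderWeight σ μ u * P.eval u, fun x => ?_⟩
    have hI := integrable_borderWeight_mul_eval (μ := μ) h P
    rw [hInt, if_pos h, ← intervalIntegral.integral_Iic_sub_Iic hI.integrableOn hI.integrableOn]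
    ring
  · exact ⟨0, fun x => by rw [hInt, if_neg h, zero_add]⟩

theorem hasDerivAt_hInt (P : Polynomial ℝ) (x : ℝ) :
    HasDerivAt (hInt σ μ P) (borderWeight σ μ x * P.eval x) x := by
  obtain ⟨κ, h⟩ := exists_hInt_eq σ μ P
  rw [funext h]
  exact (hasDerivAt_integral_borderWeight P x).const_add κ

theorem continuous_hInt (P : Polynomial ℝ) : Continuous (hInt σ μ P) :=
  continuous_iff_continuousAt.mpr fun x => (hasDerivAt_hInt P x).continuousAt

/-- Since `(z r)' = z (r' + (2 (σ⁻² - 1) u - 2 μ σ⁻²) r)` and `σ ≠ 1`, every polynomial is, up to a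
constant, of the form `(z r)' / z` with `r` of lower degree. Hence `b ∫ z P` is a combination of
`a`, `b` and a polynomial of degree less than that of `P`. -/
theorem exists_betaFun_mul_integral_eq (hc : (σ ^ 2)⁻¹ ≠ 1) (n : ℕ) : ∀ P : Polynomial ℝ,
    P.natDegree ≤ n → ∃ (κ₁ κ₂ : ℝ) (r : Polynomial ℝ), r ∈ Polynomial.degreeLT ℝ n ∧
      ∀ x, betaFun σ μ x * ∫ u in (0 : ℝ)..x, borderWeight σ μ u * P.eval u
        = κ₁ * alphaFun σ μ x + κ₂ * betaFun σ μ x + r.eval x := by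
  induction n with
  | zero =>
    intro P hP
    refine ⟨P.coeff 0, 0, 0, Submodule.zero_mem _, fun x => ?_⟩
    rw [Polynomial.eq_C_of_natDegree_eq_zero (Nat.le_zero.mp hP), alphaFun_eq]
    simp
    ring
  | succ n ih =>
    intro P hP
    set c := (σ ^ 2)⁻¹ with hcdef
    have hc' : 2 * (c - 1) ≠ 0 := mul_ne_zero two_ne_zero (sub_ne_zero.mpr hc)
    set k := P.coeff (n + 1) / (2 * (c - 1)) with hk
    obtain ⟨r, hrd, hrc⟩ : ∃ r : Polynomial ℝ, r.natDegree ≤ n ∧ r.coeff n = k :=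
      ⟨Polynomial.C k * Polynomial.X ^ n, Polynomial.natDegree_C_mul_X_pow_le _ _, by simp⟩
    set D : Polynomial ℝ := Polynomial.derivative r
      + (Polynomial.C (2 * (c - 1)) * Polynomial.X - Polynomial.C (2 * μ * c)) * r with hD
    have hDn : D.natDegree ≤ n + 1 ∧ D.coeff (n + 1) = P.coeff (n + 1) := by
      have hr1 : r.coeff (n + 1) = 0 := Polynomial.coeff_eq_zero_of_natDegree_lt (by omega)
      have hdd : (Polynomial.derivative r).natDegree ≤ n :=
        (Polynomial.natDegree_derivative_le _).trans (by omega)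
      constructor
      · refine Polynomial.natDegree_add_le_of_degree_le (hdd.trans (by omega)) ?_
        refine Polynomial.natDegree_mul_le.trans ?_
        have : (Polynomial.C (2 * (c - 1)) * Polynomial.X
            - Polynomial.C (2 * μ * c)).natDegree ≤ 1 := by compute_degree
        omega
      · rw [hD, Polynomial.coeff_add, Polynomial.coeff_eq_zero_of_natDegree_lt
          (by omega : (Polynomial.derivative r).natDegree < n + 1), sub_mul, Polynomial.coeff_sub,
          mul_assoc, Polynomial.coeff_C_mul, Polynomial.coeff_X_mul, Polynomial.coeff_C_mul, hrc,
          hr1, hk, mul_div_cancel₀ _ hc']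
        ring
    have hQ : (P - D).natDegree ≤ n := by
      rw [Polynomial.natDegree_le_iff_coeff_eq_zero]
      intro m hm
      rcases Nat.lt_or_ge (n + 1) m with h | h
      · rw [Polynomial.coeff_sub, Polynomial.coeff_eq_zero_of_natDegree_lt (by omega),
          Polynomial.coeff_eq_zero_of_natDegree_lt (by omega), sub_zero]
      · obtain rfl : m = n + 1 := by omega
        rw [Polynomial.coeff_sub, hDn.2, sub_self]
    obtain ⟨κ₁, κ₂, s, hs, h⟩ := ih (P - D) hQ
    refine ⟨κ₁, κ₂ - r.eval 0, s + r, Submodule.add_mem _ ?_ ?_, fun x => ?_⟩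
    · exact Polynomial.degreeLT_mono (Nat.le_succ n) hs
    · rw [Polynomial.mem_degreeLT]
      refine Polynomial.degree_le_natDegree.trans_lt ?_
      exact_mod_cast Nat.lt_succ_of_le hrd
    · have hcont : ∀ R : Polynomial ℝ, Continuous fun u => borderWeight σ μ u * R.eval u :=
        fun R => continuous_borderWeight.mul R.continuous
      have hFTC : ∫ u in (0 : ℝ)..x, borderWeight σ μ u * D.eval u
          = borderWeight σ μ x * r.eval x - borderWeight σ μ 0 * r.eval 0 := by
        refine intervalIntegral.integral_eq_sub_of_hasDerivAt
          (f := fun u => borderWeight σ μ u * r.eval u) (fun u _ => ?_)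
          ((hcont D).intervalIntegrable _ _)
        refine ((hasDerivAt_borderWeight u).mul (r.hasDerivAt u)).congr_deriv ?_
        simp only [hD, Polynomial.eval_add, Polynomial.eval_mul, Polynomial.eval_sub,
          Polynomial.eval_C, Polynomial.eval_X]
        ring
      have hz0 : borderWeight σ μ 0 = 1 := by simp [borderWeight]
      have hsplit : ∫ u in (0 : ℝ)..x, borderWeight σ μ u * P.eval u
          = (∫ u in (0 : ℝ)..x, borderWeight σ μ u * (P - D).eval u)
            + ∫ u in (0 : ℝ)..x, borderWeight σ μ u * D.eval u := by
        rw [← intervalIntegral.integral_add ((hcont _).intervalIntegrable _ _)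
          ((hcont _).intervalIntegrable _ _)]
        refine intervalIntegral.integral_congr fun u _ => ?_
        simp only [Polynomial.eval_sub]
        ring
      have hbz := betaFun_mul_borderWeight (σ := σ) (μ := μ) x
      rw [hsplit, mul_add, h x, hFTC, hz0, Polynomial.eval_add]
      linear_combination r.eval x * hbz

/-! ### The density as a biorthogonal ensemble -/

/-- Polynomials of degree less than `n` are combinations of the Hermite polynomials of degree less
than `n`. -/
theorem eval_mem_of_mem_degreeLT {n : ℕ} {V : Submodule ℝ (ℝ → ℝ)} (hV : ∀ j < n, hermiteH j ∈ V)
    {r : Polynomial ℝ} (hr : r ∈ Polynomial.degreeLT ℝ n) : (fun x => r.eval x) ∈ V := by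
  let S : Polynomial.Sequence ℝ :=
    { elems' := physHermite
      degree_eq' := fun i => by
        have h := natDegree_physHermite i
        have h0 : physHermite i ≠ 0 := by
          intro h0
          have := coeff_physHermite_self i
          rw [h0, Polynomial.coeff_zero] at this
          exact absurd this.symm (by positivity)
        rw [Polynomial.degree_eq_natDegree h0, h] }
  have hu : ∀ i < n, IsUnit (S i).leadingCoeff := fun i _ =>
    isUnit_iff_ne_zero.mpr (Polynomial.leadingCoeff_ne_zero.mpr (S.ne_zero i))
  let φ : Polynomial ℝ →ₗ[ℝ] (ℝ → ℝ) := LinearMap.pi fun x => Polynomial.leval x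
  suffices h : Polynomial.degreeLT ℝ n ≤ V.comap φ from h hr
  rw [← S.span_degreeLT hu, Submodule.span_le]
  rintro _ ⟨i, hi, rfl⟩
  exact hV i hi

/-- Passing from functions `g_j` to combinations of them multiplies all determinants
`det [g_j(λ_k)]` by the same constant. -/
theorem exists_det_eq_const_mul {n : ℕ} {f g : Fin n → ℝ → ℝ}
    (h : ∀ i, f i ∈ Submodule.span ℝ (Set.range g)) : ∃ C : ℝ, ∀ l : Fin n → ℝ,
    (Matrix.of fun j k => f j (l k)).det = C * (Matrix.of fun j k => g j (l k)).det := by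
  choose T hT using fun i => (Submodule.mem_span_range_iff_exists_fun ℝ).mp (h i)
  refine ⟨(Matrix.of T).det, fun l => ?_⟩
  rw [← Matrix.det_mul]
  congr 1
  ext j k
  rw [Matrix.of_apply, ← hT j, Matrix.mul_apply]
  simp

theorem hermiteH_mem_span_etaFun {N j : ℕ} (hj : j < N - 1) :
    hermiteH j ∈ Submodule.span ℝ (Set.range (etaFun N σ μ)) := by
  refine Submodule.subset_span ⟨⟨j, by omega⟩, ?_⟩
  simp only [etaFun]
  rw [if_pos (by omega)]

theorem mem_span_of_hermiteTail_mem {n : ℕ} {V : Submodule ℝ (ℝ → ℝ)} {f : ℝ → ℝ}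
    (hV : ∀ j < n, hermiteH j ∈ V) (hf : hermiteTail f n ∈ V) : f ∈ V := by
  have h : f = hermiteTail f n + ∑ p ∈ Finset.range n, hermiteCoeff f p • hermiteH p := by
    ext x
    simp [hermiteTail]
  rw [h]
  exact V.add_mem hf (V.sum_mem fun p hp => V.smul_mem _ (hV p (Finset.mem_range.mp hp)))

theorem betaFun_mem_span_etaFun {N : ℕ} (hN : 1 ≤ N) :
    betaFun σ μ ∈ Submodule.span ℝ (Set.range (etaFun N σ μ)) := by
  refine mem_span_of_hermiteTail_mem (n := N - 1) (fun j hj => hermiteH_mem_span_etaFun hj)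
    (Submodule.subset_span ⟨⟨N - 1, by omega⟩, ?_⟩)
  simp only [etaFun]
  rw [if_neg (by omega), if_pos (by omega)]
  rfl

theorem alphaFun_mem_span_etaFun (N : ℕ) :
    alphaFun σ μ ∈ Submodule.span ℝ (Set.range (etaFun N σ μ)) := by
  refine mem_span_of_hermiteTail_mem (n := N - 1) (fun j hj => hermiteH_mem_span_etaFun hj)
    (Submodule.subset_span ⟨Fin.last N, ?_⟩)
  simp only [etaFun, Fin.val_last]
  rw [if_neg (by omega), if_neg (by omega)]
  rfl

theorem inv_sq_ne_one (hσ : 0 < σ) (hσ1 : σ ≠ 1) : (σ ^ 2)⁻¹ ≠ 1 := by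
  rw [Ne, inv_eq_one]
  intro h
  exact hσ1 ((pow_eq_one_iff_of_nonneg hσ.le two_ne_zero).mp h)

theorem betaFun_mul_hInt_mem_span {N : ℕ} (hN : 1 ≤ N) (hσ : 0 < σ) (hσ1 : σ ≠ 1)
    {P : Polynomial ℝ} (hP : P.natDegree ≤ N - 1) :
    (fun x => betaFun σ μ x * hInt σ μ P x) ∈ Submodule.span ℝ (Set.range (etaFun N σ μ)) := by
  set V := Submodule.span ℝ (Set.range (etaFun N σ μ)) with hV
  obtain ⟨κ, hκ⟩ := exists_hInt_eq σ μ P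
  obtain ⟨κ₁, κ₂, r, hr, h⟩ := exists_betaFun_mul_integral_eq (μ := μ) (inv_sq_ne_one hσ hσ1)
    (N - 1) P hP
  have e : (fun x => betaFun σ μ x * hInt σ μ P x)
      = κ₁ • alphaFun σ μ + (κ + κ₂) • betaFun σ μ + fun x => r.eval x := by
    ext x
    rw [hκ, mul_add, h]
    simp
    ring
  rw [e]
  exact V.add_mem (V.add_mem (V.smul_mem _ (alphaFun_mem_span_etaFun N))
    (V.smul_mem _ (betaFun_mem_span_etaFun hN)))
    (eval_mem_of_mem_degreeLT (fun j hj => hermiteH_mem_span_etaFun hj) hr)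

theorem exp_sum_eq_prod {n : ℕ} (l : Fin n → ℝ) :
    Real.exp (-(σ ^ 2)⁻¹ * ∑ j, l j ^ 2 + 2 * μ * (σ ^ 2)⁻¹ * ∑ j, l j)
      = (∏ j, gaussWeight (l j)) * ∏ j, betaFun σ μ (l j) := by
  rw [← Finset.prod_mul_distrib]
  simp_rw [gaussWeight_mul_betaFun]
  rw [← Real.exp_sum, Finset.sum_add_distrib, Finset.mul_sum, Finset.mul_sum]

/-- The eigenvalue density is, up to a constant, the weight of the biorthogonal ensemble. -/
theorem exists_borderedWeight_eq {N : ℕ} (hN : 1 ≤ N) (hσ : 0 < σ) (hσ1 : σ ≠ 1)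
    {p q : ℕ → Polynomial ℝ} (hp : ∀ j, (p j).natDegree = j) (hq : ∀ j, (q j).natDegree = j) :
    ∃ C : ℝ, ∀ l, borderedWeight N σ μ p q l
      = C * biorthogonalWeight gaussWeight (xiFun N) (etaFun N σ μ) l := by
  obtain ⟨C₁, h₁⟩ := exists_det_eq_const_mul (f := fun (j : Fin (N + 1)) x => (q j).eval x)
    (g := xiFun N) fun j => by
      refine eval_mem_of_mem_degreeLT (n := N + 1)
        (fun i hi => Submodule.subset_span (Set.mem_range_self (⟨i, hi⟩ : Fin (N + 1)))) ?_
      rw [Polynomial.mem_degreeLT]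
      refine Polynomial.degree_le_natDegree.trans_lt ?_
      rw [hq]
      exact_mod_cast j.isLt
  obtain ⟨C₂, h₂⟩ := exists_det_eq_const_mul
    (f := fun (k : Fin (N + 1)) x =>
      betaFun σ μ x * if (k : ℕ) < N then hInt σ μ (p k) x else 1)
    (g := etaFun N σ μ) fun k => by
      by_cases hk : (k : ℕ) < N
      · simp only [if_pos hk]
        exact betaFun_mul_hInt_mem_span hN hσ hσ1 (by rw [hp]; omega)
      · simp only [if_neg hk, mul_one]
        exact betaFun_mem_span_etaFun hN
  refine ⟨C₁ * C₂, fun l => ?_⟩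
  have hdiag : ∀ l : Fin (N + 1) → ℝ, (Matrix.of fun (k j : Fin (N + 1)) =>
      betaFun σ μ (l j) * if (k : ℕ) < N then hInt σ μ (p k) (l j) else 1).det
      = (∏ j, betaFun σ μ (l j)) * (Matrix.of fun j k : Fin (N + 1) =>
        if (k : ℕ) < N then hInt σ μ (p k) (l j) else 1).det := by
    intro l
    rw [← Matrix.det_diagonal, ← Matrix.det_mul, ← Matrix.det_transpose]
    congr 1
    ext j k
    rw [Matrix.diagonal_mul]
    rfl
  have h₂l := (hdiag l).symm.trans (h₂ l)
  unfold borderedWeight biorthogonalWeight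
  rw [exp_sum_eq_prod, h₁]
  linear_combination (∏ j, gaussWeight (l j)) * C₁
    * (Matrix.of fun j k => xiFun N j (l k)).det * h₂l

end Border

/-! ### Sign of the density -/

section Sign

variable {σ μ : ℝ} {N : ℕ} {p q : ℕ → Polynomial ℝ}

/-- The functions `h_0, …, h_{N-1}, 1` form a Chebyshev system: by Rolle's theorem, a combination
with `N + 1` zeros would have a derivative `z Q` with `N` zeros, where `Q` is a polynomial of degree
less than `N`. -/
theorem det_hInt_ne_zero (hp : ∀ j, (p j).Monic ∧ (p j).natDegree = j) {l : Fin (N + 1) → ℝ}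
    (hl : StrictMono l) :
    (Matrix.of fun j k : Fin (N + 1) =>
      if (k : ℕ) < N then hInt σ μ (p k) (l j) else 1).det ≠ 0 := by
  intro hdet
  obtain ⟨v, hv0, hv⟩ := Matrix.exists_mulVec_eq_zero_iff.mpr hdet
  apply hv0
  set F : ℝ → ℝ := fun x => ∑ i : Fin N, v i.castSucc * hInt σ μ (p i) x + v (Fin.last N) with hF
  set Q : Polynomial ℝ := ∑ i : Fin N, v i.castSucc • p i with hQ
  have hFl : ∀ j, F (l j) = 0 := by
    intro j
    have h := congrFun hv j
    simp only [Matrix.mulVec, dotProduct, Matrix.of_apply, Fin.sum_univ_castSucc, Fin.val_castSucc,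
      Fin.is_lt, if_true, Fin.val_last, lt_irrefl, if_false, one_mul, Pi.zero_apply] at h
    rw [← h, hF]
    simp only [mul_comm]
  have hFd : ∀ x, HasDerivAt F (borderWeight σ μ x * Q.eval x) x := by
    intro x
    have h := HasDerivAt.fun_sum (u := Finset.univ) fun (i : Fin N) _ =>
      (hasDerivAt_hInt (σ := σ) (μ := μ) (p i) x).const_mul (v i.castSucc)
    refine (h.add_const (v (Fin.last N))).congr_deriv ?_
    rw [hQ, Polynomial.eval_finsetSum, Finset.mul_sum]
    refine Finset.sum_congr rfl fun i _ => ?_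
    rw [Polynomial.eval_smul, smul_eq_mul]
    ring
  -- the zeros of `Q` between consecutive zeros of `F`
  have hroot : ∀ i : Fin N, ∃ u ∈ Set.Ioo (l i.castSucc) (l i.succ), Q.eval u = 0 := by
    intro i
    obtain ⟨u, hu, h⟩ := exists_hasDerivAt_eq_zero (hl i.castSucc_lt_succ)
      (fun x _ => (hFd x).continuousAt.continuousWithinAt)
      ((hFl i.castSucc).trans (hFl i.succ).symm) (fun x _ => hFd x)
    exact ⟨u, hu, (mul_eq_zero.mp h).resolve_left (borderWeight_pos u).ne'⟩
  choose u hu hu0 using hroot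
  have hinj : Function.Injective u := by
    refine StrictMono.injective fun i j hij => ?_
    exact (hu i).2.trans_le ((hl.monotone (Fin.succ_le_castSucc_iff.mpr hij)).trans (hu j).1.le)
  have hQ0 : Q = 0 := by
    rcases Nat.eq_zero_or_pos N with h0 | h0
    · subst h0
      simp [hQ]
    · refine Polynomial.eq_zero_of_natDegree_lt_card_of_eval_eq_zero Q hinj hu0 ?_
      rw [Fintype.card_fin]
      refine (Polynomial.natDegree_sum_le_of_forall_le (n := N - 1) _ _ fun i _ => ?_).trans_lt
        (by omega)
      refine (Polynomial.natDegree_smul_le _ _).trans ?_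
      rw [(hp i).2]
      omega
  have hvi : ∀ i : Fin N, v i.castSucc = 0 := by
    let S : Polynomial.Sequence ℝ :=
      { elems' := p
        degree_eq' := fun i => by
          rw [Polynomial.degree_eq_natDegree (hp i).1.ne_zero, (hp i).2] }
    have hli := S.linearIndependent.comp (fun i : Fin N => (i : ℕ)) Fin.val_injective
    exact Fintype.linearIndependent_iff.mp hli (fun i => v i.castSucc) hQ0
  have hlast : v (Fin.last N) = 0 := by
    have h := hFl 0
    simpa [hF, hvi] using h
  ext j
  refine Fin.lastCases hlast (fun i => hvi i) j

theorem det_eval_ne_zero (hq : ∀ j, (q j).Monic ∧ (q j).natDegree = j) {l : Fin (N + 1) → ℝ}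
    (hl : StrictMono l) : (Matrix.of fun j k : Fin (N + 1) => (q j).eval (l k)).det ≠ 0 := by
  have h := Matrix.det_eval_matrixOfPolynomials_eq_det_vandermonde l
    (fun j : Fin (N + 1) => q j) (fun j => (hq j).2) (fun j => (hq j).1)
  have e : (Matrix.of fun j k : Fin (N + 1) => (q j).eval (l k)).det
      = (Matrix.vandermonde l).det := by
    rw [h, ← Matrix.det_transpose]
    rfl
  rw [e]
  exact Matrix.det_vandermonde_ne_zero_iff.mpr hl.injective

theorem borderedWeight_ne_zero (hp : ∀ j, (p j).Monic ∧ (p j).natDegree = j)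
    (hq : ∀ j, (q j).Monic ∧ (q j).natDegree = j) {l : Fin (N + 1) → ℝ} (hl : StrictMono l) :
    borderedWeight N σ μ p q l ≠ 0 :=
  mul_ne_zero (mul_ne_zero (Real.exp_pos _).ne' (det_eval_ne_zero hq hl)) (det_hInt_ne_zero hp hl)

theorem continuous_borderedWeight : Continuous (borderedWeight N σ μ p q) := by
  unfold borderedWeight
  refine Continuous.mul (Continuous.mul (by fun_prop) ?_) ?_
  · refine Continuous.matrix_det (continuous_matrix fun j k => ?_)
    exact (q j).continuous.comp (continuous_apply k)
  · refine Continuous.matrix_det (continuous_matrix fun j k => ?_)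
    simp only [Matrix.of_apply]
    split_ifs
    · exact (continuous_hInt _).comp (continuous_apply j)
    · exact continuous_const

theorem borderedWeight_comp_perm (τ : Equiv.Perm (Fin (N + 1))) (l : Fin (N + 1) → ℝ) :
    borderedWeight N σ μ p q (l ∘ τ) = borderedWeight N σ μ p q l := by
  have h1 := Matrix.det_permute' τ (Matrix.of fun j k : Fin (N + 1) => (q j).eval (l k))
  have h2 := Matrix.det_permute τ (Matrix.of fun j k : Fin (N + 1) =>
    if (k : ℕ) < N then hInt σ μ (p k) (l j) else 1)
  have e1 : ∑ j, (l ∘ τ) j ^ 2 = ∑ j, l j ^ 2 := Equiv.sum_comp τ fun j => l j ^ 2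
  have e2 : ∑ j, (l ∘ τ) j = ∑ j, l j := Equiv.sum_comp τ l
  have hs : ((Equiv.Perm.sign τ : ℤ) : ℝ) * ((Equiv.Perm.sign τ : ℤ) : ℝ) = 1 := by
    rw [← Int.cast_mul, ← Units.val_mul, Int.units_mul_self]
    simp
  unfold borderedWeight
  rw [e1, e2]
  change _ * ((Matrix.of fun j k : Fin (N + 1) => (q j).eval (l k)).submatrix id τ).det
    * ((Matrix.of fun j k : Fin (N + 1) =>
      if (k : ℕ) < N then hInt σ μ (p k) (l j) else 1).submatrix τ id).det = _
  rw [h1, h2]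
  generalize (Matrix.of fun j k : Fin (N + 1) => (q j).eval (l k)).det = A
  generalize (Matrix.of fun j k : Fin (N + 1) =>
    if (k : ℕ) < N then hInt σ μ (p k) (l j) else 1).det = B
  linear_combination Real.exp (-(σ ^ 2)⁻¹ * ∑ j, l j ^ 2 + 2 * μ * (σ ^ 2)⁻¹ * ∑ j, l j)
    * A * B * hs

/-- The weight does not change sign: it is continuous and without zeros on the convex chamber
`l_0 < ⋯ < l_N`, it is symmetric, and it vanishes off the images of this chamber. -/
theorem borderedWeight_mul_nonneg (hp : ∀ j, (p j).Monic ∧ (p j).natDegree = j)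
    (hq : ∀ j, (q j).Monic ∧ (q j).natDegree = j) {l₀ : Fin (N + 1) → ℝ} (hl₀ : StrictMono l₀)
    (l : Fin (N + 1) → ℝ) :
    0 ≤ borderedWeight N σ μ p q l₀ * borderedWeight N σ μ p q l := by
  have hchamber : ∀ l' : Fin (N + 1) → ℝ, StrictMono l' →
      0 ≤ borderedWeight N σ μ p q l₀ * borderedWeight N σ μ p q l' := by
    intro l' hl'
    have hconv : Convex ℝ {x : Fin (N + 1) → ℝ | StrictMono x} := by
      intro x hx y hy a b ha hb hab i j hij
      have h1 := hx hij
      have h2 := hy hij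
      simp only [Pi.add_apply, Pi.smul_apply, smul_eq_mul]
      rcases ha.eq_or_lt with rfl | ha'
      · have : b = 1 := by linarith
        subst this
        linarith
      · nlinarith
    by_contra! hneg
    have hcont : ContinuousOn
        (fun x => borderedWeight N σ μ p q l₀ * borderedWeight N σ μ p q x)
        {x : Fin (N + 1) → ℝ | StrictMono x} :=
      (continuous_const.mul continuous_borderedWeight).continuousOn
    have hivt := hconv.isPreconnected.intermediate_value hl' hl₀ hcont
    obtain ⟨x, hx, hx0⟩ := hivt ⟨hneg.le, mul_self_nonneg (borderedWeight N σ μ p q l₀)⟩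
    exact mul_ne_zero (borderedWeight_ne_zero hp hq hl₀) (borderedWeight_ne_zero hp hq hx) hx0
  by_cases hinj : Function.Injective l
  · rw [← borderedWeight_comp_perm (Tuple.sort l) l]
    exact hchamber _ ((Tuple.monotone_sort l).strictMono_of_injective
      (hinj.comp (Tuple.sort l).injective))
  · simp only [Function.Injective, not_forall] at hinj
    obtain ⟨i, j, hij, hne⟩ := hinj
    have h0 : borderedWeight N σ μ p q l = 0 := by
      unfold borderedWeight
      rw [Matrix.det_zero_of_column_eq hne fun k => by simp only [Matrix.of_apply, hij], mul_zero,
        zero_mul]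
    rw [h0, mul_zero]

theorem strictMono_natCast_fin : StrictMono fun i : Fin (N + 1) => ((i : ℕ) : ℝ) :=
  fun _ _ h => Nat.cast_lt.mpr h

theorem borderedWeight_integral_ne_zero (hp : ∀ j, (p j).Monic ∧ (p j).natDegree = j)
    (hq : ∀ j, (q j).Monic ∧ (q j).natDegree = j) (hI : Integrable (borderedWeight N σ μ p q)) :
    ∫ l : Fin (N + 1) → ℝ, borderedWeight N σ μ p q l ≠ 0 := by
  set l₀ : Fin (N + 1) → ℝ := fun i => ((i : ℕ) : ℝ)
  have hl₀ : StrictMono l₀ := strictMono_natCast_fin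
  have h0 := borderedWeight_ne_zero (σ := σ) (μ := μ) hp hq hl₀
  have hpos : 0 < ∫ l, borderedWeight N σ μ p q l₀ * borderedWeight N σ μ p q l :=
    integral_pos_of_integrable_nonneg_nonzero (x := l₀)
      (continuous_const.mul continuous_borderedWeight) (hI.const_mul _)
      (fun l => borderedWeight_mul_nonneg hp hq hl₀ l) (mul_ne_zero h0 h0)
  rw [integral_const_mul] at hpos
  exact (mul_ne_zero_iff.mp hpos.ne').2

theorem borderedDensity_nonneg (hp : ∀ j, (p j).Monic ∧ (p j).natDegree = j)
    (hq : ∀ j, (q j).Monic ∧ (q j).natDegree = j) (l : Fin (N + 1) → ℝ) :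
    0 ≤ borderedDensity N σ μ p q l := by
  set l₀ : Fin (N + 1) → ℝ := fun i => ((i : ℕ) : ℝ)
  have hl₀ : StrictMono l₀ := strictMono_natCast_fin
  have h0 := borderedWeight_ne_zero (σ := σ) (μ := μ) hp hq hl₀
  have h := borderedWeight_mul_nonneg (σ := σ) (μ := μ) hp hq hl₀
  have hI : 0 ≤ ∫ l, borderedWeight N σ μ p q l₀ * borderedWeight N σ μ p q l := integral_nonneg h
  rw [integral_const_mul] at hI
  unfold borderedDensity
  rw [← mul_div_mul_left _ _ h0]
  exact div_nonneg (h l) hI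

end Sign

/-! ### The matrix of inner products -/

section Gram

variable {σ μ : ℝ}

theorem mul_hermiteTail_eq (f : ℝ → ℝ) (n j : ℕ) (x : ℝ) :
    gaussWeight x * hermiteH j x * hermiteTail f n x
      = gaussWeight x * f x * hermiteH j x - ∑ p ∈ Finset.range n,
        hermiteCoeff f p * (gaussWeight x * hermiteH j x * hermiteH p x) := by
  simp only [hermiteTail, mul_sub, Finset.mul_sum]
  congr 1
  · ring
  · exact Finset.sum_congr rfl fun p _ => by ring

theorem integrable_mul_hermiteTail {f : ℝ → ℝ} (hf : GaussDominated f) (n j : ℕ) :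
    Integrable fun x => gaussWeight x * hermiteH j x * hermiteTail f n x := by
  simp_rw [mul_hermiteTail_eq]
  exact (hf.integrable j).sub (integrable_finsetSum _ fun p _ =>
    (integrable_hermiteH_mul_eval j (physHermite p)).const_mul _)

/-- The tail of a function has the Hermite coefficients of the function from degree `n` on. -/
theorem integral_mul_hermiteTail {f : ℝ → ℝ} (hf : GaussDominated f) (n j : ℕ) :
    ∫ x, gaussWeight x * hermiteH j x * hermiteTail f n x
      = if j < n then 0 else hermiteCoeff f j * hermiteNorm j := by
  have hI : ∀ p, Integrable fun x =>
      hermiteCoeff f p * (gaussWeight x * hermiteH j x * hermiteH p x) := fun p =>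
    (integrable_hermiteH_mul_eval j (physHermite p)).const_mul _
  simp_rw [mul_hermiteTail_eq]
  rw [integral_sub (hf.integrable j) (integrable_finsetSum _ fun p _ => hI p),
    integral_finsetSum _ fun p _ => hI p, ← hermiteCoeff_mul_norm]
  have h : ∀ p, ∫ x, hermiteCoeff f p * (gaussWeight x * hermiteH j x * hermiteH p x)
      = if j = p then hermiteCoeff f j * hermiteNorm j else 0 := by
    intro p
    rw [integral_const_mul, integral_hermiteH_mul_hermiteH]
    split_ifs with h
    · rw [h]
    · rw [mul_zero]
  simp_rw [h]
  rw [Finset.sum_ite_eq]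
  by_cases h : j < n <;> simp [h]

theorem integrable_xiFun_mul_etaFun (hσ : 0 < σ) (N : ℕ) (i j : Fin (N + 1)) :
    Integrable fun x => gaussWeight x * xiFun N i x * etaFun N σ μ j x := by
  unfold etaFun
  split_ifs
  · exact integrable_hermiteH_mul_eval i (physHermite j)
  · exact integrable_mul_hermiteTail (gaussDominated_betaFun hσ) _ _
  · exact integrable_mul_hermiteTail (gaussDominated_alphaFun hσ) _ _

/-- The lower right block of the matrix of inner products. -/
noncomputable def gramBlock (m : ℕ) (σ μ : ℝ) : Matrix (Fin 2) (Fin 2) ℝ :=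
  !![betaCoeff σ μ m * hermiteNorm m, alphaCoeff σ μ m * hermiteNorm m;
     betaCoeff σ μ (m + 1) * hermiteNorm (m + 1), alphaCoeff σ μ (m + 1) * hermiteNorm (m + 1)]

/-- The matrix of inner products is block diagonal: `H_j` for `j < N - 1` is orthogonal to the tails
`η_N`, `η_{N+1}`. -/
theorem gramMatrix_submatrix (hσ : 0 < σ) (m : ℕ) :
    (gramMatrix gaussWeight (xiFun (m + 1)) (etaFun (m + 1) σ μ)).submatrix
        (finSumFinEquiv (m := m) (n := 2)) (finSumFinEquiv (m := m) (n := 2))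
      = Matrix.fromBlocks (Matrix.diagonal fun i : Fin m => hermiteNorm i) 0 0
          (gramBlock m σ μ) := by
  have hη0 : ∀ i : Fin m, etaFun (m + 1) σ μ (Fin.castAdd 2 i) = hermiteH i := by
    intro i
    simp [etaFun]
  have hη1 : etaFun (m + 1) σ μ (Fin.natAdd m (0 : Fin 2)) = hermiteTail (betaFun σ μ) m := by
    simp [etaFun, etaN]
  have hη2 : etaFun (m + 1) σ μ (Fin.natAdd m (1 : Fin 2)) = hermiteTail (alphaFun σ μ) m := by
    simp [etaFun, etaSucc]
  have hb := integral_mul_hermiteTail (gaussDominated_betaFun (μ := μ) hσ) m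
  have ha := integral_mul_hermiteTail (gaussDominated_alphaFun (μ := μ) hσ) m
  ext (i | i) (j | j)
  · simp [gramMatrix, hη0, xiFun, integral_hermiteH_mul_hermiteH, Matrix.diagonal_apply,
      Fin.ext_iff]
  · fin_cases j
    · simpa [gramMatrix, xiFun, hη1] using hb i
    · simpa [gramMatrix, xiFun, hη2] using ha i
  · have : m + (i : ℕ) ≠ j := by omega
    simp [gramMatrix, hη0, xiFun, integral_hermiteH_mul_hermiteH, this]
  · fin_cases i <;> fin_cases j
    · simpa [gramMatrix, xiFun, hη1, gramBlock, betaCoeff] using hb m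
    · simpa [gramMatrix, xiFun, hη2, gramBlock, alphaCoeff] using ha m
    · simpa [gramMatrix, xiFun, hη1, gramBlock, betaCoeff] using hb (m + 1)
    · simpa [gramMatrix, xiFun, hη2, gramBlock, alphaCoeff] using ha (m + 1)

theorem det_gramBlock (m : ℕ) (σ μ : ℝ) : (gramBlock m σ μ).det
    = hermiteNorm m * hermiteNorm (m + 1) * (betaCoeff σ μ m * alphaCoeff σ μ (m + 1)
        - betaCoeff σ μ (m + 1) * alphaCoeff σ μ m) := by
  rw [gramBlock, Matrix.det_fin_two_of]
  ring

theorem det_gramMatrix (hσ : 0 < σ) (m : ℕ) :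
    (gramMatrix gaussWeight (xiFun (m + 1)) (etaFun (m + 1) σ μ)).det
      = (∏ i : Fin m, hermiteNorm i) * (gramBlock m σ μ).det := by
  rw [← Matrix.det_submatrix_equiv_self (finSumFinEquiv (m := m) (n := 2)),
    gramMatrix_submatrix hσ, Matrix.det_fromBlocks_zero₂₁, Matrix.det_diagonal]

/-- The explicit kernel, from the inverse of the block diagonal matrix of inner products. -/
theorem borderedKernel_eq (hσ : 0 < σ) (m : ℕ) (hD : betaCoeff σ μ m * alphaCoeff σ μ (m + 1)
      - betaCoeff σ μ (m + 1) * alphaCoeff σ μ m ≠ 0) (x y : ℝ) :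
    borderedKernel (m + 1) σ μ x y
      = gueKernel m x y
        + Real.exp (-(x ^ 2 + y ^ 2) / 2)
            / (betaCoeff σ μ m * alphaCoeff σ μ (m + 1)
                - betaCoeff σ μ (m + 1) * alphaCoeff σ μ m)
          * ((alphaCoeff σ μ (m + 1) / hermiteNorm m * hermiteH m x
                - alphaCoeff σ μ m / hermiteNorm (m + 1) * hermiteH (m + 1) x)
                * hermiteTail (betaFun σ μ) m y
            + (betaCoeff σ μ m / hermiteNorm (m + 1) * hermiteH (m + 1) x
                - betaCoeff σ μ (m + 1) / hermiteNorm m * hermiteH m x)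
              * hermiteTail (alphaFun σ μ) m y) := by
  have hsqrt : √(gaussWeight x * gaussWeight y) = Real.exp (-(x ^ 2 + y ^ 2) / 2) := by
    rw [gaussWeight, gaussWeight, ← Real.exp_add, Real.sqrt_eq_rpow, ← Real.exp_mul]
    ring_nf
  have hn := (hermiteNorm_pos m).ne'
  have hn1 := (hermiteNorm_pos (m + 1)).ne'
  have hBdet : IsUnit (gramBlock m σ μ).det := by
    rw [det_gramBlock]
    exact isUnit_iff_ne_zero.mpr (mul_ne_zero (mul_ne_zero hn hn1) hD)
  have hdiag : IsUnit (Matrix.diagonal fun i : Fin m => hermiteNorm i).det := by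
    rw [Matrix.det_diagonal]
    exact isUnit_iff_ne_zero.mpr (Finset.prod_ne_zero_iff.mpr fun i _ => (hermiteNorm_pos i).ne')
  set e := finSumFinEquiv (m := m) (n := 2) with he
  have hinv : (gramMatrix gaussWeight (xiFun (m + 1)) (etaFun (m + 1) σ μ))⁻¹.submatrix e e
      = Matrix.fromBlocks (Matrix.diagonal fun i : Fin m => (hermiteNorm i)⁻¹) 0 0
          (gramBlock m σ μ)⁻¹ := by
    rw [← Matrix.inv_submatrix_equiv, gramMatrix_submatrix hσ]
    refine Matrix.inv_eq_left_inv ?_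
    rw [Matrix.fromBlocks_multiply, Matrix.diagonal_mul_diagonal, Matrix.nonsing_inv_mul _ hBdet]
    have : (fun i : Fin m => (hermiteNorm i)⁻¹ * hermiteNorm i) = fun _ => 1 :=
      funext fun i => inv_mul_cancel₀ (hermiteNorm_pos i).ne'
    simp [this]
  have hentry : ∀ i j, (gramMatrix gaussWeight (xiFun (m + 1)) (etaFun (m + 1) σ μ))⁻¹ (e i) (e j)
      = Matrix.fromBlocks (Matrix.diagonal fun i : Fin m => (hermiteNorm i)⁻¹) 0 0
          (gramBlock m σ μ)⁻¹ i j := fun i j => congrFun (congrFun hinv i) j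
  have hη0 : ∀ i : Fin m, etaFun (m + 1) σ μ (e (Sum.inl i)) = hermiteH i := by
    intro i
    simp [etaFun, he]
  have hη1 : etaFun (m + 1) σ μ (e (Sum.inr 0)) = hermiteTail (betaFun σ μ) m := by
    simp [etaFun, etaN, he]
  have hη2 : etaFun (m + 1) σ μ (e (Sum.inr 1)) = hermiteTail (alphaFun σ μ) m := by
    simp [etaFun, etaSucc, he]
  have hξ0 : ∀ i : Fin m, xiFun (m + 1) (e (Sum.inl i)) x = hermiteH i x := fun i => rfl
  have hξ1 : xiFun (m + 1) (e (Sum.inr 0)) x = hermiteH m x := rfl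
  have hξ2 : xiFun (m + 1) (e (Sum.inr 1)) x = hermiteH (m + 1) x := rfl
  have hsum : ∑ p, ∑ q, (gramMatrix gaussWeight (xiFun (m + 1)) (etaFun (m + 1) σ μ))⁻¹ q p
      * xiFun (m + 1) p x * etaFun (m + 1) σ μ q y
      = ∑ i : Fin m, (hermiteNorm i)⁻¹ * hermiteH i x * hermiteH i y
        + ∑ p : Fin 2, ∑ q : Fin 2, (gramBlock m σ μ)⁻¹ q p
          * xiFun (m + 1) (e (Sum.inr p)) x * etaFun (m + 1) σ μ (e (Sum.inr q)) y := by
    rw [← Equiv.sum_comp e, Fintype.sum_sum_type]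
    congr 1
    · refine Finset.sum_congr rfl fun i _ => ?_
      rw [← Equiv.sum_comp e, Fintype.sum_sum_type]
      simp only [hentry, hη0, hξ0, Matrix.fromBlocks_apply₁₁, Matrix.fromBlocks_apply₂₁,
        Matrix.zero_apply, zero_mul, Finset.sum_const_zero, add_zero]
      rw [Finset.sum_eq_single i (fun j _ hj => by rw [Matrix.diagonal_apply_ne _ hj]; ring)
        (fun h => absurd (Finset.mem_univ i) h), Matrix.diagonal_apply_eq]
    · refine Finset.sum_congr rfl fun i _ => ?_
      rw [← Equiv.sum_comp e, Fintype.sum_sum_type]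
      simp only [hentry, Matrix.fromBlocks_apply₁₂, Matrix.fromBlocks_apply₂₂,
        Matrix.zero_apply, zero_mul, Finset.sum_const_zero, zero_add]
  have hBinv : (gramBlock m σ μ)⁻¹ = (gramBlock m σ μ).det⁻¹ •
      !![alphaCoeff σ μ (m + 1) * hermiteNorm (m + 1), -(alphaCoeff σ μ m * hermiteNorm m);
        -(betaCoeff σ μ (m + 1) * hermiteNorm (m + 1)), betaCoeff σ μ m * hermiteNorm m] := by
    rw [Matrix.inv_def, Ring.inverse_eq_inv', gramBlock, Matrix.adjugate_fin_two_of]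
  unfold borderedKernel biorthogonalKernel gueKernel
  rw [hsum, hsqrt, mul_add, Finset.sum_range]
  congr 1
  · congr 1
    exact Finset.sum_congr rfl fun i _ => by ring
  · rw [Fin.sum_univ_two, Fin.sum_univ_two, Fin.sum_univ_two, hξ1, hξ2, hη1, hη2, hBinv,
      det_gramBlock]
    simp only [Matrix.smul_apply, smul_eq_mul, Matrix.of_apply, Matrix.cons_val',
      Matrix.cons_val_zero, Matrix.cons_val_one, Matrix.cons_val_fin_one]
    field_simp
    ring

end Gram

theorem hasSum_hermiteTail {f : ℝ → ℝ} {x : ℝ}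
    (h : HasSum (fun j => hermiteCoeff f j * hermiteH j x) (f x)) (n : ℕ) :
    HasSum (fun j => hermiteCoeff f (n + j) * hermiteH (n + j) x) (hermiteTail f n x) := by
  have := (hasSum_nat_add_iff' n).mpr h
  simpa only [hermiteTail, add_comm n] using this

theorem mainTheorem4 (N : ℕ) (hN : 1 ≤ N) (σ μ : ℝ) (hσ : 0 < σ) (hσ1 : σ ≠ 1)
    (p q : ℕ → Polynomial ℝ)
    (hp : ∀ j, (p j).Monic ∧ (p j).natDegree = j)
    (hq : ∀ j, (q j).Monic ∧ (q j).natDegree = j) :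
    -- orthogonality of the Hermite polynomials
    (∀ j k : ℕ, Integrable (fun x => gaussWeight x * hermiteH j x * hermiteH k x) ∧
      (∫ x : ℝ, gaussWeight x * hermiteH j x * hermiteH k x)
        = if j = k then hermiteNorm j else 0) ∧
    -- the integrals that define the expansion coefficients converge
    (∀ j : ℕ, Integrable (fun x => gaussWeight x * betaFun σ μ x * hermiteH j x) ∧
      Integrable (fun x => gaussWeight x * alphaFun σ μ x * hermiteH j x)) ∧
    -- for `σ² < 2` the Hermite expansions converge, and `η_N`, `η_{N+1}` are their tails
    (σ ^ 2 < 2 → ∀ x : ℝ,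
      HasSum (fun j : ℕ => alphaCoeff σ μ j * hermiteH j x) (alphaFun σ μ x) ∧
      HasSum (fun j : ℕ => betaCoeff σ μ j * hermiteH j x) (betaFun σ μ x) ∧
      HasSum (fun j : ℕ => betaCoeff σ μ (N - 1 + j) * hermiteH (N - 1 + j) x)
        (etaN N σ μ x) ∧
      HasSum (fun j : ℕ => alphaCoeff σ μ (N - 1 + j) * hermiteH (N - 1 + j) x)
        (etaSucc N σ μ x)) ∧
    -- the eigenvalue density is a symmetric probability density on `ℝ^{N+1}`
    (Integrable (borderedWeight N σ μ p q) ∧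
      (∫ l : Fin (N + 1) → ℝ, borderedWeight N σ μ p q l) ≠ 0 ∧
      (∀ l, 0 ≤ borderedDensity N σ μ p q l) ∧
      (∫ l : Fin (N + 1) → ℝ, borderedDensity N σ μ p q l) = 1 ∧
      ∀ (τ : Equiv.Perm (Fin (N + 1))) (l : Fin (N + 1) → ℝ),
        borderedDensity N σ μ p q (l ∘ τ) = borderedDensity N σ μ p q l) ∧
    -- it is a biorthogonal ensemble
    ((gramMatrix gaussWeight (xiFun N) (etaFun N σ μ)).det ≠ 0 ∧
      ∀ l : Fin (N + 1) → ℝ,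
        borderedDensity N σ μ p q l
          = biorthogonalWeight gaussWeight (xiFun N) (etaFun N σ μ) l
            / (((N + 1).factorial : ℝ)
                * (gramMatrix gaussWeight (xiFun N) (etaFun N σ μ)).det)) ∧
    -- `borderedKernel` is its correlation kernel
    (∀ (k : ℕ) (hk : k ≤ N + 1) (x : Fin k → ℝ),
      Integrable (fun y : Fin (N + 1 - k) → ℝ => borderedDensity N σ μ p q (joinConfig hk x y)) ∧
      correlationFun (borderedDensity N σ μ p q) hk x
        = (Matrix.of fun i j : Fin k => borderedKernel N σ μ (x i) (x j)).det) ∧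
    -- the explicit form of the kernel
    betaCoeff σ μ (N - 1) * alphaCoeff σ μ N - betaCoeff σ μ N * alphaCoeff σ μ (N - 1) ≠ 0 ∧
    ∀ x y : ℝ,
      borderedKernel N σ μ x y
        = gueKernel (N - 1) x y
          + Real.exp (-(x ^ 2 + y ^ 2) / 2)
              / (betaCoeff σ μ (N - 1) * alphaCoeff σ μ N
                  - betaCoeff σ μ N * alphaCoeff σ μ (N - 1))
            * ((alphaCoeff σ μ N / hermiteNorm (N - 1) * hermiteH (N - 1) x
                  - alphaCoeff σ μ (N - 1) / hermiteNorm N * hermiteH N x) * etaN N σ μ y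
              + (betaCoeff σ μ (N - 1) / hermiteNorm N * hermiteH N x
                  - betaCoeff σ μ N / hermiteNorm (N - 1) * hermiteH (N - 1) x)
                * etaSucc N σ μ y) := by
  have hw : ∀ x, 0 ≤ gaussWeight x := fun x => (gaussWeight_pos x).le
  have ha := gaussDominated_alphaFun (μ := μ) hσ
  have hb := gaussDominated_betaFun (μ := μ) hσ
  have hint := integrable_xiFun_mul_etaFun (μ := μ) hσ N
  obtain ⟨C, hC⟩ := exists_borderedWeight_eq (μ := μ) hN hσ hσ1 (fun j => (hp j).2)
    fun j => (hq j).2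
  have hI : Integrable (borderedWeight N σ μ p q) := by
    rw [funext hC]
    exact (integrable_biorthogonalWeight hint).const_mul C
  have hZ := borderedWeight_integral_ne_zero hp hq hI
  have hZeq : ∫ l : Fin (N + 1) → ℝ, borderedWeight N σ μ p q l
      = C * (((N + 1).factorial : ℝ)
        * (gramMatrix gaussWeight (xiFun N) (etaFun N σ μ)).det) := by
    simp_rw [hC]
    rw [integral_const_mul, integral_biorthogonalWeight hint]
  -- neither the constant nor the determinant vanishes, because the total mass does not
  have hg : (gramMatrix gaussWeight (xiFun N) (etaFun N σ μ)).det ≠ 0 := by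
    intro h
    rw [hZeq, h, mul_zero, mul_zero] at hZ
    exact hZ rfl
  have hC0 : C ≠ 0 := by
    intro h
    rw [hZeq, h, zero_mul] at hZ
    exact hZ rfl
  have hdens : ∀ l : Fin (N + 1) → ℝ, borderedDensity N σ μ p q l
      = biorthogonalWeight gaussWeight (xiFun N) (etaFun N σ μ) l
        / (((N + 1).factorial : ℝ)
            * (gramMatrix gaussWeight (xiFun N) (etaFun N σ μ)).det) := by
    intro l
    rw [borderedDensity, hZeq, hC, mul_div_mul_left _ _ hC0]
  refine ⟨fun j k => ⟨integrable_hermiteH_mul_eval j (physHermite k),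
    integral_hermiteH_mul_hermiteH j k⟩, fun j => ⟨hb.integrable j, ha.integrable j⟩, ?_,
    ⟨hI, hZ, borderedDensity_nonneg hp hq, ?_, ?_⟩, ⟨hg, hdens⟩, ?_, ?_⟩
  · intro hσ2 x
    -- `|1 - c| < c` for `c = σ⁻² > 1/2`
    have hs : |1 - (σ ^ 2)⁻¹| < 1 - (1 - (σ ^ 2)⁻¹) := by
      have : (2 : ℝ)⁻¹ < (σ ^ 2)⁻¹ := inv_strictAnti₀ (by positivity) hσ2
      rw [abs_lt]
      constructor <;> linarith
    have hsa := hasSum_hermite ha hasDerivAt_alphaFun hs x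
    have hsb := hasSum_hermite hb hasDerivAt_betaFun hs x
    exact ⟨hsa, hsb, hasSum_hermiteTail hsb (N - 1), hasSum_hermiteTail hsa (N - 1)⟩
  · simp_rw [borderedDensity]
    rw [integral_div, div_self hZ]
  · intro τ l
    rw [borderedDensity, borderedDensity, borderedWeight_comp_perm]
  · intro k hk x
    rw [funext hdens]
    exact ⟨(integrable_biorthogonalWeight_append hint (Nat.add_sub_of_le hk).symm x).div_const _,
      correlationFun_biorthogonal hw hint hg hk x⟩
  · obtain ⟨m, rfl⟩ : ∃ m, N = m + 1 := ⟨N - 1, by omega⟩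
    rw [det_gramMatrix hσ, det_gramBlock] at hg
    have hD := (mul_ne_zero_iff.mp (mul_ne_zero_iff.mp hg).2).2
    exact ⟨hD, borderedKernel_eq hσ m hD⟩
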